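/- For $w\in\mathbb N$ identify $[2^w]=\{0,\dots,2^w-1\}$ with the set of $w$-bit strings and let $\oplus$ be bitwise exclusive-or, applied coordinatewise to vectors. Let $\Phi$ and $\Psi$ be such sets. Given character tables $h_0,\dots,h_{c-1}:\Phi\to\Psi^d$, the simple tabulation function $h:\Phi^c\to\Psi^d$ is $h(x_0,\dots,x_{c-1})=h_0(x_0)\oplus\cdots\oplus h_{c-1}(x_{c-1})$. A function $f:U\to\Psi^d$ is $k$-unique if for every non-empty $X\subseteq U$ with $|X|\le k$ there are a position $j$, a character $a\in\Psi$ and a key $x\in X$ such that $f(x)_j=a$ and $f(y)_j\ne a$ for all $y\in X\setminus\{x\}$. A random function $g:\Phi\to R$ (with $R$ finite) is $k$-independent if each $g(a)$ is uniformly distributed in $R$ and $g(a_1),\dots,g(a_k)$ are independent for any distinct $a_1,\dots,a_k\in\Phi$; it is fully random if all the values $g(a)$, $a\in\Phi$, are independent and uniform in $R$. Suppose that the random character tables $h_0,\dots,h_{c-1}$ are independent of each other and that each of them is fully random or at least $100$-independent. Then: 1. (32-bit keys) for $\Phi=\Psi=[2^{16}]$, $c=2$, $d=20$, the probability that $h$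 is not $100$-unique is at most $1.5\times10^{-42}$; 2. (64-bit keys) for $\Phi=\Psi=[2^{22}]$, $c=3$, $d=24$, the probability that $h$ is not $100$-unique is at most $1.4\times10^{-49}$; 3. (64-bit keys) for $\Phi=[2^{16}]$, $\Psi=[2^{32}]$, $c=4$, $d=14$, the probability that $h$ is not $100$-unique is at most $9.0\times10^{-36}$. -/

import Mathlib

open MeasureTheory ProbabilityTheory

namespace Tabulation

/-- The set `X` of keys has a unique output position character `(j, a)` under `f : U → Ψ^d`:
exactly one key `x ∈ X` has `f(x)_j = a`. -/
def HasUniqueOutputChar {U Ψ : Type*} {d : ℕ} (f : U → Fin d → Ψ) (X : Finset U) : Prop :=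
  ∃ (j : Fin d) (a : Ψ), ∃ x ∈ X, f x j = a ∧ ∀ y ∈ X, y ≠ x → f y j ≠ a

/-- `f` is `k`-unique: every non-empty set of at most `k` keys has a unique output position
character. -/
def IsKUnique {U Ψ : Type*} {d : ℕ} (k : ℕ) (f : U → Fin d → Ψ) : Prop :=
  ∀ X : Finset U, X.Nonempty → X.card ≤ k → HasUniqueOutputChar f X

/-- The simple tabulation function `Φ^c → Ψ^d` with character tables `h i : Φ → Ψ^d`, where
`Ψ = [2^s]` is the set of `s`-bit strings: `h(x)_j = h_0(x_0)_j ⊕ ⋯ ⊕ h_{c-1}(x_{c-1})_j`. -/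
def simpleTabulation {Φ : Type*} {c d s : ℕ} (h : Fin c → Φ → Fin d → BitVec s) :
    (Fin c → Φ) → Fin d → BitVec s :=
  fun x j => Finset.univ.fold (· ^^^ ·) 0#s (fun i => h i (x i) j)

section Random

variable {Ω : Type*} [MeasurableSpace Ω]

/-- For every fixed key, its hash value is uniformly distributed in the (finite) range `R`. -/
def HasUniformValues {U R : Type*} (μ : Measure Ω) (h : Ω → U → R) : Prop :=
  ∀ (u : U) (r : R), μ {ω | h ω u = r} = (Nat.card R : ENNReal)⁻¹

/-- `k`-independent random function: any `k` distinct keys have independent hash values, and every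
hash value is uniform. The range carries the discrete σ-algebra `⊤`. -/
def IsKIndependent {U R : Type*} (k : ℕ) (μ : Measure Ω) (h : Ω → U → R) : Prop :=
  (∀ x : Fin k → U, Function.Injective x →
    iIndepFun (m := fun _ => (⊤ : MeasurableSpace R)) (fun i ω => h ω (x i)) μ) ∧
  HasUniformValues μ h

/-- Fully random function: the hash values of all keys are independent and uniform. -/
def IsFullyRandom {U R : Type*} (μ : Measure Ω) (h : Ω → U → R) : Prop :=
  iIndepFun (m := fun _ : U => (⊤ : MeasurableSpace R)) (fun u ω => h ω u) μ ∧
  HasUniformValues μ h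

/-- Random character tables `h_0, …, h_{c-1} : Φ → R` (random variables for the discrete
σ-algebra on the set of all tables) that are independent of each other, each of them being fully
random or at least `k`-independent. -/
structure AreRandomTables {Φ R : Type*} {c : ℕ} (k : ℕ) (μ : Measure Ω)
    (h : Fin c → Ω → Φ → R) : Prop where
  measurable : ∀ i, Measurable[_, (⊤ : MeasurableSpace (Φ → R))] (h i)
  indep : iIndepFun (m := fun _ => (⊤ : MeasurableSpace (Φ → R))) h μ
  random : ∀ i, IsFullyRandom μ (h i) ∨ IsKIndependent k μ (h i)

end Random

end Tabulation

namespace Tabulation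

open scoped symmDiff

/-! ### Bit strings as an elementary abelian 2-group -/

/-- The `s`-bit strings, with bitwise exclusive-or as addition. -/
def XorBits (s : ℕ) : Type := BitVec s

namespace XorBits

variable {s : ℕ}

instance : Fintype (XorBits s) := inferInstanceAs (Fintype (BitVec s))

instance : DecidableEq (XorBits s) := inferInstanceAs (DecidableEq (BitVec s))

instance : Add (XorBits s) := ⟨fun x y => BitVec.xor x y⟩

instance : Zero (XorBits s) := ⟨0#s⟩

instance : Neg (XorBits s) := ⟨fun x => x⟩

/-- The exclusive-or group structure. -/
instance : AddCommGroup (XorBits s) where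
  add_assoc x y z := BitVec.xor_assoc x y z
  zero_add x := BitVec.zero_xor
  add_zero x := BitVec.xor_zero
  add_comm x y := BitVec.xor_comm x y
  neg_add_cancel x := BitVec.xor_self
  nsmul := nsmulRec
  zsmul := zsmulRec

theorem add_self (x : XorBits s) : x + x = 0 := BitVec.xor_self

theorem card : Fintype.card (XorBits s) = 2 ^ s := by
  have h : Fintype.card (BitVec s) = 2 ^ s := by
    rw [← Nat.card_eq_fintype_card, Nat.card_congr (BitVec.equivFin (m := s)).toEquiv, Nat.card_fin]
  exact h

/-- A bit string, as an element of the group. -/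
def ofBits (x : BitVec s) : XorBits s := x

theorem ofBits_fold {ι : Type*} (T : Finset ι) (f : ι → BitVec s) :
    ofBits (T.fold (· ^^^ ·) 0#s f) = ∑ i ∈ T, ofBits (f i) := by
  classical
  induction T using Finset.induction_on with
  | empty => rfl
  | insert a T ha ih => rw [Finset.fold_insert ha, Finset.sum_insert ha, ← ih]; rfl

end XorBits

theorem sum_symmDiff_eq_zero {A R : Type*} [DecidableEq A] [AddCommGroup R]
    (h2 : ∀ r : R, r + r = 0) (K L : Finset A) (f : A → R)
    (h : ∑ a ∈ K, f a = ∑ a ∈ L, f a) : ∑ a ∈ K ∆ L, f a = 0 := by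
  have hK := Finset.sum_inter_add_sum_sdiff K L f
  have hL := Finset.sum_inter_add_sum_sdiff L K f
  have hd : Disjoint (K \ L) (L \ K) := disjoint_sdiff_sdiff
  have : ∑ a ∈ K ∆ L, f a = ∑ a ∈ K \ L, f a + ∑ a ∈ L \ K, f a := by
    rw [← Finset.sum_union hd]; rfl
  rw [this]
  rw [Finset.inter_comm L K] at hL
  have e : ∑ a ∈ K \ L, f a = ∑ a ∈ L \ K, f a :=
    add_left_cancel (hK.trans (h.trans hL.symm))
  rw [e, h2]

/-! ### Triangular families of linear relations -/

section Triangular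

variable {A D R : Type*}

/-- `α` is the element of `e` of largest rank. -/
def IsTop (ρ : A → ℕ) (e : Finset A) (α : A) : Prop := α ∈ e ∧ ∀ β ∈ e, ρ β ≤ ρ α

theorem IsTop.unique {ρ : A → ℕ} (hρ : ρ.Injective) {e : Finset A} {α β : A}
    (h : IsTop ρ e α) (h' : IsTop ρ e β) : α = β :=
  hρ (le_antisymm (h'.2 _ h.1) (h.2 _ h'.1))

theorem exists_isTop (ρ : A → ℕ) {e : Finset A} (he : e.Nonempty) : ∃ α, IsTop ρ e α := by
  obtain ⟨α, h, h'⟩ := e.exists_max_image ρ he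
  exact ⟨α, h, h'⟩

/-- A family of relations `∑ α ∈ t.2, H α t.1 = 0`, `t ∈ E`, that is in echelon form: a relation is
determined by its position `t.1` together with the top element of `t.2`. -/
def Triangular (ρ : A → ℕ) (E : Finset (D × Finset A)) : Prop :=
  (∀ t ∈ E, t.2.Nonempty) ∧
  ∀ t ∈ E, ∀ t' ∈ E, ∀ α, t.1 = t'.1 → IsTop ρ t.2 α → IsTop ρ t'.2 α → t = t'

theorem Triangular.mono {ρ : A → ℕ} {E E' : Finset (D × Finset A)} (h : Triangular ρ E)
    (hE : E' ⊆ E) : Triangular ρ E' :=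
  ⟨fun t ht => h.1 t (hE ht), fun t ht t' ht' => h.2 t (hE ht) t' (hE ht')⟩

/-- The table `H` satisfies all relations of the family `E`. -/
def Holds [AddCommMonoid R] (H : A → D → R) (E : Finset (D × Finset A)) : Prop :=
  ∀ t ∈ E, ∑ α ∈ t.2, H α t.1 = 0

variable [Fintype A] [DecidableEq A] [Fintype D] [DecidableEq D] [AddCommGroup R] [Fintype R]
  [DecidableEq R]

open Classical in
/-- The tables that vanish outside `S` and satisfy the relations `E`. -/
noncomputable def solutions (S : Finset A) (E : Finset (D × Finset A)) : Finset (A → D → R) :=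
  Finset.univ.filter fun f => (∀ α ∉ S, f α = 0) ∧ Holds f E

theorem mem_solutions {S : Finset A} {E : Finset (D × Finset A)} {f : A → D → R} :
    f ∈ solutions S E ↔ (∀ α ∉ S, f α = 0) ∧ Holds f E := by
  simp [solutions]

theorem card_solutions_mul_le {ρ : A → ℕ} {S : Finset A}
    {E : Finset (D × Finset A)} (hE : Triangular ρ E) (hS : ∀ t ∈ E, t.2 ⊆ S)
    (hne : E.Nonempty) :
    ∃ t ∈ E, (solutions (R := R) S E).card * Fintype.card R
      ≤ (solutions (R := R) S (E.erase t)).card := by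
  have htop : ∀ t ∈ E, ∃ α, IsTop ρ t.2 α := fun t ht => exists_isTop ρ (hE.1 t ht)
  obtain ⟨t, ht, hmax⟩ := E.exists_max_image (fun t => t.2.sup ρ) hne
  obtain ⟨α, hα⟩ := htop t ht
  have hsup : t.2.sup ρ = ρ α := le_antisymm (Finset.sup_le hα.2) (Finset.le_sup hα.1)
  refine ⟨t, ht, ?_⟩
  rw [← Finset.card_univ, ← Finset.card_product]
  let bump : R → A → D → R := fun z => Pi.single α (Pi.single t.1 z)
  have hbump : ∀ (f : A → D → R) z, ∑ β ∈ t.2, (f + bump z) β t.1 = ∑ β ∈ t.2, f β t.1 + z := by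
    intro f z
    simp only [Pi.add_apply, Finset.sum_add_distrib]
    congr 1
    rw [Finset.sum_eq_single α]
    · simp [bump]
    · intro β _ hβ; simp [bump, Pi.single_eq_of_ne hβ]
    · intro h; exact absurd hα.1 h
  refine Finset.card_le_card_of_injOn (fun p => p.1 + bump p.2) ?_ ?_
  · rintro ⟨f, z⟩ hp
    simp only [Finset.coe_product, Finset.coe_univ, Set.mem_prod, Finset.mem_coe, Set.mem_univ,
      and_true, mem_solutions] at hp ⊢
    refine ⟨fun β hβ => ?_, fun t' ht' => ?_⟩
    · have : β ≠ α := fun h => hβ (h ▸ hS t ht hα.1)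
      simp [bump, hp.1 β hβ, Pi.single_eq_of_ne this]
    · obtain ⟨hne', ht'⟩ := Finset.mem_erase.1 ht'
      have hz : ∀ β ∈ t'.2, bump z β t'.1 = 0 := by
        intro β hβ
        by_cases h1 : t'.1 = t.1
        · have : β ≠ α := by
            rintro rfl
            refine hne' (hE.2 t' ht' t ht β h1 ⟨hβ, fun γ hγ => ?_⟩ hα)
            exact (Finset.le_sup hγ).trans ((hmax t' ht').trans hsup.le)
          simp [bump, Pi.single_eq_of_ne this]
        · by_cases h2 : β = α
          · subst h2; simp [bump, Pi.single_eq_of_ne h1]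
          · simp [bump, Pi.single_eq_of_ne h2]
      simp only [Pi.add_apply, Finset.sum_add_distrib]
      rw [Finset.sum_eq_zero hz, add_zero]
      exact hp.2 t' ht'
  · rintro ⟨f, z⟩ hp ⟨f', z'⟩ hp' h
    simp only [Finset.coe_product, Finset.coe_univ, Set.mem_prod, Finset.mem_coe, Set.mem_univ,
      and_true, mem_solutions] at hp hp'
    have h1 := hbump f z
    have h2 := hbump f' z'
    have h : f + bump z = f' + bump z' := h
    rw [hp.2 t ht, zero_add, h] at h1
    rw [hp'.2 t ht, zero_add] at h2
    have hz : z = z' := h1.symm.trans h2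
    subst hz
    simpa using h

theorem card_solutions_mul_pow_le {ρ : A → ℕ} {S : Finset A}
    {E : Finset (D × Finset A)} (hE : Triangular ρ E) (hS : ∀ t ∈ E, t.2 ⊆ S) :
    (solutions (R := R) S E).card * Fintype.card R ^ E.card
      ≤ Fintype.card (D → R) ^ S.card := by
  induction hn : E.card generalizing E with
  | zero =>
    rw [pow_zero, mul_one]
    refine (Finset.card_le_card (t := Fintype.piFinset fun α =>
      if α ∈ S then (Finset.univ : Finset (D → R)) else {0}) fun f hf => ?_).trans ?_
    · rw [Fintype.mem_piFinset]
      intro α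
      split_ifs with h
      · exact Finset.mem_univ _
      · rw [Finset.mem_singleton]; exact (mem_solutions.1 hf).1 α h
    · rw [Fintype.card_piFinset]
      simp only [apply_ite Finset.card, Finset.card_univ, Finset.card_singleton]
      rw [Finset.prod_ite]
      simp
  | succ n ih =>
    obtain ⟨t, ht, hle⟩ := card_solutions_mul_le (R := R) hE hS
      (Finset.card_pos.1 (by omega))
    have := ih (hE.mono (Finset.erase_subset t E)) (fun t' h => hS t' (Finset.mem_of_mem_erase h))
      (by rw [Finset.card_erase_of_mem ht, hn]; rfl)
    calc _ = (solutions (R := R) S E).card * Fintype.card R * Fintype.card R ^ n := by ring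
      _ ≤ _ := Nat.mul_le_mul_right _ hle
      _ ≤ _ := this

end Triangular

/-! ### The joint law of few table entries -/

section Law

variable {Ω : Type*} [MeasurableSpace Ω] {μ : Measure Ω}

theorem measure_forall_eq_of_iIndepFun [IsProbabilityMeasure μ] {ι R : Type*}
    {g : ι → Ω → R} (hg : iIndepFun (m := fun _ => (⊤ : MeasurableSpace R)) g μ)
    {q : ENNReal} (hq : ∀ i r, μ {ω | g i ω = r} = q) (T : Finset ι) (f : ι → R) :
    μ {ω | ∀ i ∈ T, g i ω = f i} = q ^ T.card := by
  have h := hg.measure_inter_preimage_eq_mul T (sets := fun i => {f i})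
    (fun i _ => MeasurableSpace.measurableSet_top)
  have e : {ω | ∀ i ∈ T, g i ω = f i} = ⋂ i ∈ T, g i ⁻¹' {f i} := by
    ext ω; simp
  rw [e, h, ← Finset.prod_const]
  exact Finset.prod_congr rfl fun i _ => hq i (f i)

theorem measure_table_eq [IsProbabilityMeasure μ] {U R : Type*} [Fintype U] {k : ℕ}
    (hk : k ≤ Fintype.card U) {h : Ω → U → R}
    (hh : IsFullyRandom μ h ∨ IsKIndependent k μ h) (T : Finset U) (hT : T.card ≤ k)
    (f : U → R) :
    μ {ω | ∀ u ∈ T, h ω u = f u} = (Nat.card R : ENNReal)⁻¹ ^ T.card := by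
  classical
  rcases hh with hh | hh
  · exact measure_forall_eq_of_iIndepFun hh.1 (fun u r => hh.2 u r) T f
  · obtain ⟨T', hTT', hT'⟩ := Finset.exists_superset_card_eq hT hk
    let x : Fin k → U := fun i => (T'.equivFinOfCardEq hT').symm i
    have hx : x.Injective := fun i j hij =>
      (T'.equivFinOfCardEq hT').symm.injective (Subtype.ext hij)
    have hm := measure_forall_eq_of_iIndepFun (hh.1 x hx) (fun i r => hh.2 (x i) r)
      (T.preimage x hx.injOn) (fun i => f (x i))
    have hTx : ∀ u ∈ T, ∃ i, x i = u := fun u hu =>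
      ⟨T'.equivFinOfCardEq hT' ⟨u, hTT' hu⟩, by simp [x]⟩
    have hc : (T.preimage x hx.injOn).card = T.card := by
      rw [Finset.card_preimage]
      congr 1
      exact Finset.filter_true_of_mem fun u hu => hTx u hu
    rw [hc] at hm
    rw [← hm]
    congr 1
    ext ω
    simp only [Set.mem_ofPred_eq, Finset.mem_preimage]
    refine ⟨fun h' i hi => h' _ hi, fun h' u hu => ?_⟩
    obtain ⟨i, rfl⟩ := hTx u hu
    exact h' i hu

theorem measure_tables_eq [IsProbabilityMeasure μ] {Φ R : Type*} [Fintype Φ] [DecidableEq Φ]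
    {c k : ℕ} (hk : k ≤ Fintype.card Φ) {h : Fin c → Ω → Φ → R} (hh : AreRandomTables k μ h)
    (S : Finset (Fin c × Φ)) (hS : ∀ i, (S.filter fun α => α.1 = i).card ≤ k)
    (f : Fin c × Φ → R) :
    μ {ω | ∀ α ∈ S, h α.1 ω α.2 = f α} = (Nat.card R : ENNReal)⁻¹ ^ S.card := by
  have hind := hh.indep.measure_inter_preimage_eq_mul Finset.univ
    (sets := fun i => {t | ∀ u ∈ (S.filter fun α => α.1 = i).image Prod.snd, t u = f (i, u)})
    (fun i _ => MeasurableSpace.measurableSet_top)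
  have hcard : ∀ i, ((S.filter fun α => α.1 = i).image Prod.snd).card
      = (S.filter fun α => α.1 = i).card := by
    intro i
    refine Finset.card_image_of_injOn fun α hα β hβ hαβ => ?_
    simp only [Finset.coe_filter, Set.mem_ofPred_eq] at hα hβ
    exact Prod.ext (hα.2.trans hβ.2.symm) hαβ
  have e : {ω | ∀ α ∈ S, h α.1 ω α.2 = f α} = ⋂ i ∈ Finset.univ, h i ⁻¹'
      {t | ∀ u ∈ (S.filter fun α => α.1 = i).image Prod.snd, t u = f (i, u)} := by
    ext ω
    simp only [Set.mem_ofPred_eq, Finset.mem_image, Finset.mem_filter, Prod.exists, Set.mem_iInter,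
      Set.mem_preimage, Finset.mem_univ, true_imp_iff]
    constructor
    · rintro h' i u ⟨i', u', ⟨hm, rfl⟩, rfl⟩
      exact h' _ hm
    · rintro h' ⟨i, u⟩ hm
      exact h' i u ⟨i, u, ⟨hm, rfl⟩, rfl⟩
  rw [e, hind]
  have : ∀ i ∈ (Finset.univ : Finset (Fin c)), μ (h i ⁻¹'
      {t | ∀ u ∈ (S.filter fun α => α.1 = i).image Prod.snd, t u = f (i, u)})
      = (Nat.card R : ENNReal)⁻¹ ^ (S.filter fun α => α.1 = i).card := by
    intro i _
    rw [← hcard i]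
    exact measure_table_eq hk (hh.random i) _ ((hcard i).trans_le (hS i)) (fun u => f (i, u))
  rw [Finset.prod_congr rfl this, Finset.prod_pow_eq_pow_sum]
  congr 1
  exact (Finset.card_eq_sum_card_fiberwise (f := Prod.fst) (t := Finset.univ)
    (fun _ _ => Finset.mem_univ _)).symm

/-- The family `E` is in echelon form for some ranking, and uses at most `k` characters from each
position. -/
def Echelon {Φ : Type*} [DecidableEq Φ] {c d : ℕ} (k : ℕ)
    (E : Finset (Fin d × Finset (Fin c × Φ))) : Prop :=
  (∃ ρ : Fin c × Φ → ℕ, Triangular ρ E) ∧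
  ∃ S : Finset (Fin c × Φ), (∀ i, (S.filter fun α => α.1 = i).card ≤ k) ∧ ∀ t ∈ E, t.2 ⊆ S

/-- The character tables as a family of elements of the group of bit strings. -/
def entries {Φ : Type*} {c d s : ℕ} (h : Fin c → Φ → Fin d → BitVec s) :
    Fin c × Φ → Fin d → XorBits s := fun α j => XorBits.ofBits (h α.1 α.2 j)

theorem measure_holds_le [IsProbabilityMeasure μ] {Φ : Type*} [Fintype Φ] [DecidableEq Φ]
    {c d s k : ℕ} (hk : k ≤ Fintype.card Φ) {h : Fin c → Ω → Φ → Fin d → BitVec s}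
    (hh : AreRandomTables k μ h) {E : Finset (Fin d × Finset (Fin c × Φ))} (hE : Echelon k E) :
    μ {ω | Holds (entries fun i => h i ω) E} ≤ ((2 : ENNReal) ^ s)⁻¹ ^ E.card := by
  obtain ⟨⟨ρ, hT⟩, S, hS, hES⟩ := hE
  have hcount := card_solutions_mul_pow_le (R := XorBits s) hT hES
  set N := (solutions (R := XorBits s) S E).card
  have hsub : {ω | Holds (entries fun i => h i ω) E} ⊆
      ⋃ f ∈ solutions (R := XorBits s) S E,
        {ω | ∀ α ∈ S, entries (fun i => h i ω) α = f α} := by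
    intro ω hω
    simp only [Set.mem_iUnion]
    refine ⟨fun α => if α ∈ S then entries (fun i => h i ω) α else 0, mem_solutions.2
      ⟨fun α hα => if_neg hα, fun t ht => ?_⟩, fun α hα => ?_⟩
    · rw [← hω t ht]
      refine Finset.sum_congr rfl fun α hα => ?_
      exact congrFun (if_pos (hES t ht hα)) t.1
    · exact (if_pos hα).symm
  have hR : (Nat.card (Fin d → BitVec s) : ENNReal) = Fintype.card (Fin d → XorBits s) := by
    rw [← Nat.card_eq_fintype_card]; rfl
  have hpos : (Fintype.card (Fin d → XorBits s) : ENNReal) ≠ 0 := by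
    exact_mod_cast Fintype.card_ne_zero
  have h2 : ((2 : ENNReal) ^ s) = (Fintype.card (XorBits s) : ENNReal) := by
    rw [XorBits.card]; push_cast; rfl
  calc μ {ω | Holds (entries fun i => h i ω) E}
      ≤ ∑ f ∈ solutions (R := XorBits s) S E,
          μ {ω | ∀ α ∈ S, entries (fun i => h i ω) α = f α} :=
        (measure_mono hsub).trans (measure_biUnion_finset_le _ _)
    _ = N * (Fintype.card (Fin d → XorBits s) : ENNReal)⁻¹ ^ S.card := by
        rw [← hR, ← nsmul_eq_mul, ← Finset.sum_const]
        exact Finset.sum_congr rfl fun f _ => measure_tables_eq hk hh S hS f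
    _ ≤ _ := by
        rw [h2, ← ENNReal.inv_pow, ← ENNReal.inv_pow, ← div_eq_mul_inv]
        have hc : (N : ENNReal) * (Fintype.card (XorBits s) : ENNReal) ^ E.card
            ≤ (Fintype.card (Fin d → XorBits s) : ENNReal) ^ S.card := by exact_mod_cast hcount
        have hr : (Fintype.card (XorBits s) : ENNReal) ^ E.card ≠ 0 :=
          pow_ne_zero _ (by exact_mod_cast Fintype.card_ne_zero)
        have hr' : (Fintype.card (XorBits s) : ENNReal) ^ E.card ≠ ⊤ :=
          ENNReal.pow_ne_top (ENNReal.natCast_ne_top _)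
        rw [ENNReal.div_le_iff (pow_ne_zero _ hpos) (ENNReal.pow_ne_top (ENNReal.natCast_ne_top _)),
          mul_comm, ← div_eq_mul_inv, ENNReal.le_div_iff_mul_le (Or.inl hr) (Or.inl hr')]
        exact hc

theorem measure_exists_holds_le [IsProbabilityMeasure μ] {Φ : Type*} [Fintype Φ] [DecidableEq Φ]
    {c d s k : ℕ} (hk : k ≤ Fintype.card Φ) {h : Fin c → Ω → Φ → Fin d → BitVec s}
    (hh : AreRandomTables k μ h) (C : Finset (Finset (Fin d × Finset (Fin c × Φ)))) {r : ℕ} :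
    μ {ω | ∃ E ∈ C, E.card = r ∧ Echelon k E ∧ Holds (entries fun i => h i ω) E}
      ≤ C.card * ((2 : ENNReal) ^ s)⁻¹ ^ r := by
  have hsub : {ω | ∃ E ∈ C, E.card = r ∧ Echelon k E ∧ Holds (entries fun i => h i ω) E} ⊆
      ⋃ E ∈ C, {ω | E.card = r ∧ Echelon k E ∧ Holds (entries fun i => h i ω) E} := by
    rintro ω ⟨E, hE, h'⟩
    simp only [Set.mem_iUnion]
    exact ⟨E, hE, h'⟩
  refine (measure_mono hsub).trans ((measure_biUnion_finset_le _ _).trans ?_)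
  rw [← nsmul_eq_mul, ← Finset.sum_const]
  refine Finset.sum_le_sum fun E _ => ?_
  by_cases hE : E.card = r ∧ Echelon k E
  · rw [← hE.1]
    exact (measure_mono fun ω hω => hω.2.2).trans (measure_holds_le hk hh hE.2)
  · have : {ω | E.card = r ∧ Echelon k E ∧ Holds (entries fun i => h i ω) E} = ∅ := by
      ext ω
      simp only [Set.mem_ofPred_eq, Set.mem_empty_iff_false, iff_false]
      exact fun h' => hE ⟨h'.1, h'.2.1⟩
    rw [this, measure_empty]
    exact zero_le

end Law

end Tabulation

namespace Tabulation

open scoped symmDiff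

/-! ### Relations forced by a set of keys without a unique output character -/

section Keys

variable {Φ R : Type*} [Fintype Φ] [DecidableEq Φ] {c d : ℕ} [AddCommGroup R]

/-- The set of position characters of a key. -/
def keySet (x : Fin c → Φ) : Finset (Fin c × Φ) := Finset.univ.filter fun α => x α.1 = α.2

theorem mem_keySet {x : Fin c → Φ} {α : Fin c × Φ} : α ∈ keySet x ↔ x α.1 = α.2 := by
  simp [keySet]

/-- The tabulation hash value of a key. -/
def hashSum (H : Fin c × Φ → Fin d → R) (x : Fin c → Φ) (j : Fin d) : R :=
  ∑ α ∈ keySet x, H α j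

theorem sum_keySet {M : Type*} [AddCommMonoid M] (x : Fin c → Φ) (f : Fin c × Φ → M) :
    ∑ α ∈ keySet x, f α = ∑ i, f (i, x i) := by
  symm
  refine Finset.sum_bij (fun i _ => (i, x i)) ?_ ?_ ?_ ?_
  · intro i _; simp [mem_keySet]
  · intro i _ j _ h; exact congrArg Prod.fst h
  · rintro ⟨i, a⟩ h
    rw [mem_keySet] at h
    exact ⟨i, Finset.mem_univ _, Prod.ext rfl h⟩
  · intro i _; rfl

/-- Every key of `X` shares each of its output characters with another key of `X`. -/
def Covered (H : Fin c × Φ → Fin d → R) (X : Finset (Fin c → Φ)) : Prop :=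
  X.Nonempty ∧ ∀ x ∈ X, ∀ j, ∃ y ∈ X, y ≠ x ∧ hashSum H y j = hashSum H x j

/-- The number of keys of `X` containing a position character. -/
def deg (X : Finset (Fin c → Φ)) (α : Fin c × Φ) : ℕ := (X.filter fun x => x α.1 = α.2).card

theorem deg_le_card (X : Finset (Fin c → Φ)) (α : Fin c × Φ) : deg X α ≤ X.card :=
  Finset.card_filter_le _ _

theorem exists_rank (X : Finset (Fin c → Φ)) :
    ∃ ρ : Fin c × Φ → ℕ, ρ.Injective ∧ ∀ α β, deg X β < deg X α → ρ α < ρ β := by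
  set N := Fintype.card (Fin c × Φ)
  let e := Fintype.equivFin (Fin c × Φ)
  refine ⟨fun α => (X.card - deg X α) * N + e α, fun α β h => ?_, fun α β h => ?_⟩
  · have h' := congrArg (· % N) h
    simp only [Nat.mul_add_mod_self_right] at h'
    rw [Nat.mod_eq_of_lt (e α).2, Nat.mod_eq_of_lt (e β).2] at h'
    exact e.injective (Fin.ext h')
  · have h1 := deg_le_card X α
    have h2 : X.card - deg X α + 1 ≤ X.card - deg X β := by omega
    have h3 := Nat.mul_le_mul_right N h2
    have h4 := (e α).2
    show (X.card - deg X α) * N + e α < (X.card - deg X β) * N + e β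
    rw [Nat.add_mul] at h3
    omega

open Classical in
/-- The top characters of the relations at position `j` between keys of `X`. -/
noncomputable def pivots (H : Fin c × Φ → Fin d → R) (X : Finset (Fin c → Φ))
    (ρ : Fin c × Φ → ℕ) (j : Fin d) : Finset (Fin c × Φ) :=
  Finset.univ.filter fun α => ∃ x ∈ X, ∃ y ∈ X,
    hashSum H x j = hashSum H y j ∧ IsTop ρ (keySet x ∆ keySet y) α

theorem mem_pivots {H : Fin c × Φ → Fin d → R} {X : Finset (Fin c → Φ)}
    {ρ : Fin c × Φ → ℕ} {j : Fin d} {α : Fin c × Φ} :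
    α ∈ pivots H X ρ j ↔ ∃ x ∈ X, ∃ y ∈ X,
      hashSum H x j = hashSum H y j ∧ IsTop ρ (keySet x ∆ keySet y) α := by
  simp [pivots]

theorem keySet_symmDiff_nonempty {x y : Fin c → Φ} (h : x ≠ y) :
    (keySet x ∆ keySet y).Nonempty := by
  obtain ⟨i, hi⟩ := Function.ne_iff.1 h
  exact ⟨(i, x i), Finset.mem_symmDiff.2 (Or.inl ⟨mem_keySet.2 rfl,
    fun h' => hi (mem_keySet.1 h').symm⟩)⟩

theorem exists_pivot {H : Fin c × Φ → Fin d → R} {X : Finset (Fin c → Φ)}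
    (ρ : Fin c × Φ → ℕ) {j : Fin d} {x y : Fin c → Φ} (hx : x ∈ X) (hy : y ∈ X) (hxy : x ≠ y)
    (h : hashSum H x j = hashSum H y j) :
    ∃ α ∈ pivots H X ρ j, x α.1 = α.2 ∨ y α.1 = α.2 := by
  obtain ⟨α, hα⟩ := exists_isTop ρ (keySet_symmDiff_nonempty hxy)
  refine ⟨α, mem_pivots.2 ⟨x, hx, y, hy, h, hα⟩, ?_⟩
  rcases Finset.mem_symmDiff.1 hα.1 with h | h
  · exact Or.inl (mem_keySet.1 h.1)
  · exact Or.inr (mem_keySet.1 h.1)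

theorem card_le_two_mul_sum_deg {H : Fin c × Φ → Fin d → R} {X : Finset (Fin c → Φ)}
    (hX : Covered H X) (ρ : Fin c × Φ → ℕ) (j : Fin d) :
    X.card ≤ 2 * ∑ α ∈ pivots H X ρ j, deg X α := by
  classical
  set hit : (Fin c → Φ) → Prop := fun x => ∃ α ∈ pivots H X ρ j, x α.1 = α.2 with hhit
  have h1 : (X.filter hit).card ≤ ∑ α ∈ pivots H X ρ j, deg X α := by
    refine (Finset.card_le_card (t := (pivots H X ρ j).biUnion
      fun α => X.filter fun x => x α.1 = α.2) fun x hx => ?_).trans Finset.card_biUnion_le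
    obtain ⟨hx, α, hα, hxα⟩ := Finset.mem_filter.1 hx
    exact Finset.mem_biUnion.2 ⟨α, hα, Finset.mem_filter.2 ⟨hx, hxα⟩⟩
  have h2 : (X.filter fun x => ¬ hit x).card ≤ (X.filter hit).card := by
    have hp : ∀ x, ∃ y, x ∈ X → y ∈ X ∧ y ≠ x ∧ hashSum H y j = hashSum H x j := by
      intro x
      by_cases hx : x ∈ X
      · obtain ⟨y, hy⟩ := hX.2 x hx j
        exact ⟨y, fun _ => hy⟩
      · exact ⟨x, fun h => absurd h hx⟩
    choose q hq using hp
    refine Finset.card_le_card_of_injOn q ?_ ?_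
    · intro x hx
      obtain ⟨hx, hn⟩ := Finset.mem_filter.1 hx
      obtain ⟨hy, hne, he⟩ := hq x hx
      obtain ⟨α, hα, h | h⟩ := exists_pivot ρ hy hx hne he
      · exact Finset.mem_filter.2 ⟨hy, α, hα, h⟩
      · exact absurd ⟨α, hα, h⟩ hn
    · intro x hx x' hx' hxx'
      obtain ⟨hx, hn⟩ := Finset.mem_filter.1 hx
      obtain ⟨hx', hn'⟩ := Finset.mem_filter.1 hx'
      by_contra hne
      have he : hashSum H x j = hashSum H x' j := by
        rw [← (hq x hx).2.2, hxx', (hq x' hx').2.2]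
      obtain ⟨α, hα, h | h⟩ := exists_pivot ρ hx hx' hne he
      · exact hn ⟨α, hα, h⟩
      · exact hn' ⟨α, hα, h⟩
  have h3 := Finset.card_filter_add_card_filter_not (s := X) hit
  omega

theorem sum_card_level (X : Finset (Fin c → Φ)) (T : Finset (Fin c × Φ)) :
    ∑ g ∈ Finset.Icc 1 X.card, (T.filter fun α => g ≤ deg X α).card = ∑ α ∈ T, deg X α := by
  simp only [Finset.card_filter]
  rw [Finset.sum_comm]
  refine Finset.sum_congr rfl fun α _ => ?_
  rw [← Finset.card_filter]
  have : (Finset.Icc 1 X.card).filter (fun g => g ≤ deg X α) = Finset.Icc 1 (deg X α) := by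
    ext g
    have := deg_le_card X α
    simp only [Finset.mem_filter, Finset.mem_Icc]
    omega
  rw [this]
  simp

theorem sum_deg_position (X : Finset (Fin c → Φ)) (i : Fin c) :
    ∑ α with α.1 = i, deg X α = X.card := by
  rw [Finset.card_eq_sum_card_fiberwise (s := X) (f := fun x => ((i, x i) : Fin c × Φ))
    (t := Finset.univ.filter fun α : Fin c × Φ => α.1 = i) (fun x _ => by simp)]
  refine Finset.sum_congr rfl fun α hα => ?_
  have hi : α.1 = i := (Finset.mem_filter.1 hα).2
  unfold deg
  congr 1
  ext x
  simp only [Finset.mem_filter, and_congr_right_iff]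
  intro _
  subst hi
  constructor
  · intro h; exact Prod.ext rfl h
  · intro h; exact congrArg Prod.snd h

/-- The characters contained in at least `g` keys of `X`. -/
def level (X : Finset (Fin c → Φ)) (g : ℕ) : Finset (Fin c × Φ) :=
  Finset.univ.filter fun α => g ≤ deg X α

theorem mem_level {X : Finset (Fin c → Φ)} {g : ℕ} {α : Fin c × Φ} :
    α ∈ level X g ↔ g ≤ deg X α := by
  simp [level]

theorem sum_card_level_position (X : Finset (Fin c → Φ)) (i : Fin c) :
    ∑ g ∈ Finset.Icc 1 X.card, ((level X g).filter fun α => α.1 = i).card = X.card := by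
  refine Eq.trans ?_ ((sum_card_level X _).trans (sum_deg_position X i))
  refine Finset.sum_congr rfl fun g _ => ?_
  rw [level, Finset.filter_comm]

theorem card_level_position_le (X : Finset (Fin c → Φ)) {g : ℕ} (hg : 1 ≤ g) (i : Fin c) :
    ((level X g).filter fun α => α.1 = i).card ≤ X.card := by
  rw [← sum_deg_position X i, Finset.card_eq_sum_ones]
  refine (Finset.sum_le_sum (g := deg X) fun α hα => ?_).trans
    (Finset.sum_le_sum_of_subset fun α hα => ?_)
  · exact hg.trans (mem_level.1 (Finset.mem_filter.1 hα).1)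
  · exact Finset.mem_filter.2 ⟨Finset.mem_univ _, (Finset.mem_filter.1 hα).2⟩

theorem card_not_position (S : Finset (Fin c × Φ)) (i : Fin c) :
    (S.filter fun α => α.1 ≠ i).card
      = ∑ i' ∈ Finset.univ.erase i, (S.filter fun α => α.1 = i').card := by
  rw [Finset.card_eq_sum_card_fiberwise (f := Prod.fst) (t := Finset.univ.erase i)
    (fun α hα => by simpa using (Finset.mem_filter.1 hα).2)]
  refine Finset.sum_congr rfl fun i' hi' => ?_
  rw [Finset.filter_filter]
  congr 1
  ext α
  simp only [Finset.mem_filter]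
  have := Finset.ne_of_mem_erase hi'
  grind

theorem sum_card_level_not_position (X : Finset (Fin c → Φ)) (i : Fin c) :
    ∑ g ∈ Finset.Icc 1 X.card, ((level X g).filter fun α => α.1 ≠ i).card
      = (c - 1) * X.card := by
  simp only [card_not_position]
  rw [Finset.sum_comm, Finset.sum_congr rfl fun i' _ => sum_card_level_position X i']
  simp

theorem subset_level_of_isTop {X : Finset (Fin c → Φ)} {ρ : Fin c × Φ → ℕ}
    (hρ : ∀ α β, deg X β < deg X α → ρ α < ρ β) {e : Finset (Fin c × Φ)} {α : Fin c × Φ}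
    (h : IsTop ρ e α) {g : ℕ} (hg : g ≤ deg X α) : e ⊆ level X g := by
  intro β hβ
  rw [mem_level]
  by_contra hlt
  exact absurd (hρ α β (by omega)) (not_lt.2 (h.2 β hβ))

theorem card_symmDiff_position (x y : Fin c → Φ) (i : Fin c) :
    ((keySet x ∆ keySet y).filter fun α => α.1 = i) = ∅ ∨
    ((keySet x ∆ keySet y).filter fun α => α.1 = i).card = 2 := by
  by_cases h : x i = y i
  · left
    ext ⟨i', a⟩
    simp only [Finset.mem_filter, Finset.mem_symmDiff, mem_keySet, Finset.notMem_empty, iff_false]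
    rintro ⟨h', rfl⟩
    rw [h] at h'
    tauto
  · right
    rw [Finset.card_eq_two]
    refine ⟨(i, x i), (i, y i), by simpa using h, ?_⟩
    ext ⟨i', a⟩
    simp only [Finset.mem_filter, Finset.mem_symmDiff, mem_keySet, Finset.mem_insert,
      Finset.mem_singleton, Prod.mk.injEq]
    constructor
    · rintro ⟨h' | h', rfl⟩
      · exact Or.inl ⟨rfl, h'.1.symm⟩
      · exact Or.inr ⟨rfl, h'.1.symm⟩
    · rintro (⟨rfl, rfl⟩ | ⟨rfl, rfl⟩)
      · exact ⟨Or.inl ⟨rfl, fun h' => h h'.symm⟩, rfl⟩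
      · exact ⟨Or.inr ⟨rfl, fun h' => h h'⟩, rfl⟩

theorem exists_dominating_pair {H : Fin c × Φ → Fin d → R} {X : Finset (Fin c → Φ)}
    (hX : ∃ x ∈ X, ∃ y ∈ X, x ≠ y) {ρ : Fin c × Φ → ℕ}
    (hρ : ∀ α β, deg X β < deg X α → ρ α < ρ β) :
    ∃ α β : Fin c × Φ, α ≠ β ∧ α.1 = β.1 ∧ 1 ≤ deg X α ∧ 1 ≤ deg X β ∧
      ∀ j g, ∀ γ ∈ pivots H X ρ j, g ≤ deg X γ → g ≤ deg X α ∧ g ≤ deg X β := by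
  obtain ⟨x, hx, y, hy, hxy⟩ := hX
  obtain ⟨i, hi⟩ := Function.ne_iff.1 hxy
  let T : Finset ((Fin c × Φ) × (Fin c × Φ)) :=
    Finset.univ.filter fun p => p.1 ≠ p.2 ∧ p.1.1 = p.2.1
  have hT : ∀ z w : Fin c → Φ, ∀ i, z i ≠ w i → ((i, z i), (i, w i)) ∈ T := by
    intro z w i h
    simp [T, h]
  obtain ⟨⟨α, β⟩, hp, hmax⟩ := T.exists_max_image (fun p => min (deg X p.1) (deg X p.2))
    ⟨_, hT x y i hi⟩
  have hpos : ∀ z ∈ X, ∀ i, 1 ≤ deg X (i, z i) := fun z hz i =>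
    Finset.card_pos.2 ⟨z, Finset.mem_filter.2 ⟨hz, rfl⟩⟩
  have h1 := hmax _ (hT x y i hi)
  have := hpos x hx i
  have := hpos y hy i
  simp only at h1
  obtain ⟨hne, hfst⟩ := (Finset.mem_filter.1 hp).2
  refine ⟨α, β, hne, hfst, by omega, by omega, fun j g γ hγ hg => ?_⟩
  obtain ⟨z, hz, w, hw, -, htop⟩ := mem_pivots.1 hγ
  have hsub := subset_level_of_isTop hρ htop hg
  have hzw : z γ.1 ≠ w γ.1 := by
    intro h
    have := htop.1
    rw [Finset.mem_symmDiff, mem_keySet, mem_keySet, h] at this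
    tauto
  have hm1 : ((γ.1, z γ.1) : Fin c × Φ) ∈ keySet z ∆ keySet w := by
    simp [Finset.mem_symmDiff, mem_keySet, Ne.symm hzw]
  have hm2 : ((γ.1, w γ.1) : Fin c × Φ) ∈ keySet z ∆ keySet w := by
    simp [Finset.mem_symmDiff, mem_keySet, hzw]
  have h2 := hmax _ (hT z w γ.1 hzw)
  have h3 := mem_level.1 (hsub hm1)
  have h4 := mem_level.1 (hsub hm2)
  simp only at h2
  omega

theorem exists_level_average {H : Fin c × Φ → Fin d → R} {X : Finset (Fin c → Φ)}
    (hX : Covered H X) {ρ : Fin c × Φ → ℕ} {α β : Fin c × Φ}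
    (hα : 1 ≤ deg X α) (hβ : 1 ≤ deg X β)
    (hdom : ∀ j g, ∀ γ ∈ pivots H X ρ j, g ≤ deg X γ → g ≤ deg X α ∧ g ≤ deg X β)
    {L₁ L₂ D : ℕ} (hL : 2 * (L₁ + (c - 1) * L₂) ≤ D * d) :
    ∃ g, 1 ≤ g ∧ g ≤ deg X α ∧ g ≤ deg X β ∧
      L₁ * ((level X g).filter fun γ => γ.1 = α.1).card
        + L₂ * ((level X g).filter fun γ => γ.1 ≠ α.1).card
      ≤ D * ∑ j, ((pivots H X ρ j).filter fun γ => g ≤ deg X γ).card := by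
  by_contra! hcon
  have hm : 1 ≤ X.card := Finset.card_pos.2 hX.1
  have hlt : ∑ g ∈ Finset.Icc 1 X.card,
        D * ∑ j, ((pivots H X ρ j).filter fun γ => g ≤ deg X γ).card
      < ∑ g ∈ Finset.Icc 1 X.card, (L₁ * ((level X g).filter fun γ => γ.1 = α.1).card
        + L₂ * ((level X g).filter fun γ => γ.1 ≠ α.1).card) := by
    refine Finset.sum_lt_sum (fun g hg => ?_) ⟨1, Finset.mem_Icc.2 ⟨le_rfl, hm⟩,
      hcon 1 le_rfl hα hβ⟩
    by_cases h : g ≤ deg X α ∧ g ≤ deg X β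
    · exact (hcon g (Finset.mem_Icc.1 hg).1 h.1 h.2).le
    · have : ∀ j, (pivots H X ρ j).filter (fun γ => g ≤ deg X γ) = ∅ := fun j =>
        Finset.filter_eq_empty_iff.2 fun γ hγ hg => h (hdom j g γ hγ hg)
      simp [this]
  rw [Finset.sum_add_distrib, ← Finset.mul_sum, ← Finset.mul_sum, ← Finset.mul_sum,
    sum_card_level_position, sum_card_level_not_position, Finset.sum_comm] at hlt
  simp only [sum_card_level] at hlt
  have hhit : d * X.card ≤ 2 * ∑ j, ∑ γ ∈ pivots H X ρ j, deg X γ := by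
    rw [Finset.mul_sum]
    calc d * X.card = ∑ _j : Fin d, X.card := by simp
      _ ≤ _ := Finset.sum_le_sum fun j _ => card_le_two_mul_sum_deg hX ρ j
  have h1 := Nat.mul_le_mul_left D hhit
  have h2 := Nat.mul_le_mul_right X.card hL
  nlinarith

/-- A nonempty set of characters of `S` with no or two characters at each position. -/
def IsDiff (S e : Finset (Fin c × Φ)) : Prop :=
  e ⊆ S ∧ e.Nonempty ∧ ∀ i, (e.filter fun α => α.1 = i) = ∅ ∨ (e.filter fun α => α.1 = i).card = 2

/-- A set of characters of `S` with at most one character at each position. -/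
def IsTrace (S u : Finset (Fin c × Φ)) : Prop :=
  u ⊆ S ∧ ∀ i, (u.filter fun α => α.1 = i).card ≤ 1

/-- The relations `E` in the characters `S` come from pairs among at most `k` traces. -/
def Traced (k : ℕ) (S : Finset (Fin c × Φ)) (E : Finset (Fin d × Finset (Fin c × Φ))) : Prop :=
  ∃ Q : Finset (Finset (Fin c × Φ)), Q.card ≤ k ∧ (∀ u ∈ Q, IsTrace S u) ∧
    ∀ t ∈ E, ∃ u ∈ Q, ∃ v ∈ Q, t.2 = u ∆ v

theorem exists_relations (h2 : ∀ r : R, r + r = 0) {H : Fin c × Φ → Fin d → R}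
    {X : Finset (Fin c → Φ)} {k : ℕ} (hk : X.card ≤ k) (hX : Covered H X) (hd : 0 < d) :
    ∃ (ρ : Fin c × Φ → ℕ) (α β : Fin c × Φ), ρ.Injective ∧ α ≠ β ∧ α.1 = β.1 ∧
      ∀ L₁ L₂ D : ℕ, 2 * (L₁ + (c - 1) * L₂) ≤ D * d →
      ∃ (S : Finset (Fin c × Φ)) (E : Finset (Fin d × Finset (Fin c × Φ))),
        α ∈ S ∧ β ∈ S ∧ (∀ i, (S.filter fun γ => γ.1 = i).card ≤ k) ∧ Triangular ρ E ∧
        Holds H E ∧ (∀ t ∈ E, IsDiff S t.2) ∧ Traced k S E ∧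
        L₁ * (S.filter fun γ => γ.1 = α.1).card + L₂ * (S.filter fun γ => γ.1 ≠ α.1).card
          ≤ D * E.card := by
  classical
  obtain ⟨ρ, hρ, hdeg⟩ := exists_rank X
  have htwo : ∃ x ∈ X, ∃ y ∈ X, x ≠ y := by
    obtain ⟨x, hx⟩ := hX.1
    obtain ⟨y, hy, hne, -⟩ := hX.2 x hx ⟨0, hd⟩
    exact ⟨y, hy, x, hx, hne⟩
  obtain ⟨α, β, hne, hfst, hα, hβ, hdom⟩ := exists_dominating_pair (H := H) htwo hdeg
  refine ⟨ρ, α, β, hρ, hne, hfst, fun L₁ L₂ D hL => ?_⟩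
  obtain ⟨g, hg, hgα, hgβ, havg⟩ := exists_level_average hX hα hβ hdom hL
  have hch : ∀ (j : Fin d) (γ : Fin c × Φ), ∃ e : Finset (Fin c × Φ), γ ∈ pivots H X ρ j →
      IsTop ρ e γ ∧ ∑ δ ∈ e, H δ j = 0 ∧ ∃ x ∈ X, ∃ y ∈ X, e = keySet x ∆ keySet y := by
    intro j γ
    by_cases hγ : γ ∈ pivots H X ρ j
    · obtain ⟨x, hx, y, hy, he, htop⟩ := mem_pivots.1 hγ
      exact ⟨_, fun _ => ⟨htop, sum_symmDiff_eq_zero h2 _ _ (fun δ => H δ j) he,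
        x, hx, y, hy, rfl⟩⟩
    · exact ⟨∅, fun h => absurd h hγ⟩
  choose e he using hch
  let I : Finset (Σ _ : Fin d, Fin c × Φ) :=
    Finset.univ.sigma fun j => (pivots H X ρ j).filter fun γ => g ≤ deg X γ
  have hI : ∀ p ∈ I, p.2 ∈ pivots H X ρ p.1 ∧ g ≤ deg X p.2 := fun p hp => by
    simpa [I] using hp
  let F : (Σ _ : Fin d, Fin c × Φ) → Fin d × Finset (Fin c × Φ) := fun p => (p.1, e p.1 p.2)
  have hkey : ∀ p ∈ I, ∀ q ∈ I, ∀ γ, p.1 = q.1 → IsTop ρ (e p.1 p.2) γ →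
      IsTop ρ (e q.1 q.2) γ → p = q := by
    rintro ⟨j, γ₁⟩ hp ⟨j', γ₂⟩ hq γ h1 ht1 ht2
    have h1 : j = j' := h1
    subst h1
    have a := ht1.unique hρ (he _ _ (hI _ hp).1).1
    have b := ht2.unique hρ (he _ _ (hI _ hq).1).1
    simp only at a b
    rw [← a, ← b]
  have hsub : ∀ p ∈ I, e p.1 p.2 ⊆ level X g := fun p hp =>
    subset_level_of_isTop hdeg (he _ _ (hI _ hp).1).1 (hI _ hp).2
  refine ⟨level X g, I.image F, mem_level.2 hgα, mem_level.2 hgβ,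
    fun i => (card_level_position_le X hg i).trans hk, ⟨?_, ?_⟩, ?_, ?_, ?_, ?_⟩
  · intro t ht
    obtain ⟨p, hp, rfl⟩ := Finset.mem_image.1 ht
    exact ⟨_, (he _ _ (hI _ hp).1).1.1⟩
  · intro t ht t' ht' γ h1 h3 h4
    obtain ⟨p, hp, rfl⟩ := Finset.mem_image.1 ht
    obtain ⟨q, hq, rfl⟩ := Finset.mem_image.1 ht'
    rw [hkey p hp q hq γ h1 h3 h4]
  · intro t ht
    obtain ⟨p, hp, rfl⟩ := Finset.mem_image.1 ht
    exact (he _ _ (hI _ hp).1).2.1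
  · intro t ht
    obtain ⟨p, hp, rfl⟩ := Finset.mem_image.1 ht
    obtain ⟨htop, -, x, -, y, -, hxy⟩ := he _ _ (hI _ hp).1
    refine ⟨hsub p hp, ⟨_, htop.1⟩, fun i => ?_⟩
    show (e p.1 p.2).filter _ = ∅ ∨ ((e p.1 p.2).filter _).card = 2
    rw [hxy]
    exact card_symmDiff_position x y i
  · refine ⟨X.image fun x => keySet x ∩ level X g, Finset.card_image_le.trans hk, ?_, ?_⟩
    · intro u hu
      obtain ⟨x, -, rfl⟩ := Finset.mem_image.1 hu
      refine ⟨Finset.inter_subset_right, fun i => Finset.card_le_one.2 ?_⟩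
      rintro ⟨i₁, a⟩ h₁ ⟨i₂, b⟩ h₂
      simp only [Finset.mem_filter, Finset.mem_inter, mem_keySet] at h₁ h₂
      obtain ⟨⟨ha, -⟩, rfl⟩ := h₁
      obtain ⟨⟨hb, -⟩, rfl⟩ := h₂
      rw [← ha, ← hb]
    · intro t ht
      obtain ⟨p, hp, rfl⟩ := Finset.mem_image.1 ht
      obtain ⟨-, -, x, hx, y, hy, hxy⟩ := he _ _ (hI _ hp).1
      refine ⟨_, Finset.mem_image_of_mem _ hx, _, Finset.mem_image_of_mem _ hy, ?_⟩
      show e p.1 p.2 = _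
      have hs := hsub p hp
      rw [hxy] at hs ⊢
      have hd := inf_symmDiff_distrib_right (keySet x) (keySet y) (level X g)
      rw [inf_eq_left.2 hs] at hd
      exact hd
  · refine havg.trans_eq ?_
    congr 1
    rw [Finset.card_image_of_injOn, Finset.card_sigma]
    intro p hp q hq hpq
    have h1 : p.1 = q.1 := congrArg Prod.fst hpq
    have h3 : e p.1 p.2 = e q.1 q.2 := congrArg Prod.snd hpq
    have ht := (he _ _ (hI p hp).1).1
    exact hkey p hp q hq _ h1 ht (h3 ▸ ht)

end Keys

end Tabulation

namespace Tabulation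

open scoped symmDiff

/-! ### Counting families of relations -/

theorem choose_le_pow_div_factorial {n N : ℕ} (h : n ≤ N) (r : ℕ) :
    n.choose r ≤ N ^ r / r.factorial := by
  rw [Nat.choose_eq_descFactorial_div_factorial]
  exact Nat.div_le_div_right ((Nat.descFactorial_le_pow n r).trans (Nat.pow_le_pow_left h r))

theorem prod_add_one_le {ι : Type*} (I : Finset ι) (n : ι → ℕ) :
    ∏ i ∈ I, (n i + 1) ≤ (∑ i ∈ I, n i + I.card) ^ I.card / I.card ^ I.card := by
  rcases I.eq_empty_or_nonempty with rfl | hI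
  · simp
  have hc : 0 < I.card := Finset.card_pos.2 hI
  rw [Nat.le_div_iff_mul_le (pow_pos hc _)]
  have h := Real.geom_mean_le_arith_mean I (fun _ => 1) (fun i => (n i : ℝ) + 1)
    (fun _ _ => zero_le_one) (by simpa using hc) (fun i _ => by positivity)
  simp only [Real.rpow_one, Finset.sum_const, nsmul_eq_mul, mul_one, one_mul,
    Finset.sum_add_distrib] at h
  have hP : 0 ≤ ∏ i ∈ I, ((n i : ℝ) + 1) := Finset.prod_nonneg fun i _ => by positivity
  have h' := pow_le_pow_left₀ (Real.rpow_nonneg hP _) h I.card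
  rw [← Real.rpow_natCast, ← Real.rpow_mul hP, inv_mul_cancel₀ (by positivity), Real.rpow_one,
    div_pow, le_div_iff₀ (by positivity)] at h'
  exact_mod_cast h'

/-- The number of sets with no or two elements in a set of `n` elements. -/
def pairCount (n : ℕ) : ℕ := 1 + n * (n - 1) / 2

/-- The value of `∏ i, pairCount (n i)` for `t` numbers that sum to `n` and are nearly equal. -/
def balanced (t n : ℕ) : ℕ := ∏ i ∈ Finset.range t, pairCount ((n + i) / t)

/-- A bound for `∏ i, pairCount (n i)` for at most `t` numbers that sum to `n`. -/
def pairBound : ℕ → ℕ → ℕ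
  | 0, _ => 1
  | 1, n => pairCount n
  | t + 2, n => max (pairBound (t + 1) n) (balanced (t + 2) n)

theorem prod_pairCount_le {ι : Type*} {m K : ℕ}
    (hB : ∀ t < m, ∀ n ≤ K, ∀ i ≤ n,
      pairCount i * pairBound t (n - i) ≤ pairBound (t + 1) n)
    (I : Finset ι) (n : ι → ℕ) (hI : I.card ≤ m) (hK : ∑ i ∈ I, n i ≤ K) :
    ∏ i ∈ I, pairCount (n i) ≤ pairBound I.card (∑ i ∈ I, n i) := by
  classical
  induction I using Finset.induction_on with
  | empty => simp [pairBound]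
  | insert a I ha ih =>
    rw [Finset.card_insert_of_notMem ha] at hI ⊢
    rw [Finset.sum_insert ha] at hK ⊢
    rw [Finset.prod_insert ha]
    refine (Nat.mul_le_mul_left _ (ih (by omega) (by omega))).trans ?_
    have := hB I.card (by omega) _ hK (n a) (by omega)
    rwa [Nat.add_sub_cancel_left] at this

section Families

variable {Φ : Type*} [Fintype Φ] [DecidableEq Φ] {c d : ℕ}

theorem card_le_prod_of_filter_mem {T : Finset (Finset (Fin c × Φ))}
    {W : Fin c → Finset (Finset (Fin c × Φ))}
    (h : ∀ e ∈ T, ∀ i, (e.filter fun α => α.1 = i) ∈ W i) : T.card ≤ ∏ i, (W i).card := by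
  rw [← Fintype.card_piFinset]
  refine Finset.card_le_card_of_injOn (fun e i => e.filter fun α => α.1 = i)
    (fun e he => Fintype.mem_piFinset.2 fun i => h e he i) fun e _ e' _ hee' => ?_
  ext α
  have := congrArg (α ∈ ·) (congrFun hee' α.1)
  simpa using this

open Classical in
/-- The possible relations in the characters `S`. -/
noncomputable def diffs (S : Finset (Fin c × Φ)) : Finset (Finset (Fin c × Φ)) :=
  Finset.univ.filter (IsDiff S)

theorem mem_diffs {S e : Finset (Fin c × Φ)} : e ∈ diffs S ↔ IsDiff S e := by simp [diffs]

open Classical in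
/-- The possible traces of keys in the characters `S`. -/
noncomputable def traces (S : Finset (Fin c × Φ)) : Finset (Finset (Fin c × Φ)) :=
  Finset.univ.filter (IsTrace S)

theorem mem_traces {S e : Finset (Fin c × Φ)} : e ∈ traces S ↔ IsTrace S e := by simp [traces]

theorem card_diffs_lt (S : Finset (Fin c × Φ)) :
    (diffs S).card < ∏ i, pairCount (S.filter fun α => α.1 = i).card := by
  have he : ∅ ∉ diffs S := fun h => Finset.not_nonempty_empty (mem_diffs.1 h).2.1
  rw [← Nat.add_one_le_iff, ← Finset.card_insert_of_notMem he]
  refine (card_le_prod_of_filter_mem (W := fun i => insert ∅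
    (Finset.powersetCard 2 (S.filter fun α => α.1 = i))) fun e he i => ?_).trans ?_
  · rw [Finset.mem_insert, Finset.mem_powersetCard]
    rcases Finset.mem_insert.1 he with rfl | he
    · simp
    · obtain ⟨hS, -, h⟩ := mem_diffs.1 he
      exact (h i).imp_right fun h => ⟨Finset.filter_subset_filter _ hS, h⟩
  · refine Finset.prod_le_prod' fun i _ => (Finset.card_insert_le _ _).trans ?_
    rw [Finset.card_powersetCard, Nat.choose_two_right, pairCount, add_comm]

theorem card_traces_le (S : Finset (Fin c × Φ)) :
    (traces S).card ≤ ∏ i, ((S.filter fun α => α.1 = i).card + 1) := by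
  refine (card_le_prod_of_filter_mem (W := fun i => insert ∅
    (Finset.powersetCard 1 (S.filter fun α => α.1 = i))) fun e he i => ?_).trans ?_
  · rw [Finset.mem_insert, Finset.mem_powersetCard]
    obtain ⟨hS, h⟩ := mem_traces.1 he
    have := h i
    rcases Nat.le_one_iff_eq_zero_or_eq_one.1 (h i) with h | h
    · exact Or.inl (Finset.card_eq_zero.1 h)
    · exact Or.inr ⟨Finset.filter_subset_filter _ hS, h⟩
  · refine Finset.prod_le_prod' fun i _ => (Finset.card_insert_le _ _).trans ?_
    rw [Finset.card_powersetCard, Nat.choose_one_right]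

open Classical in
/-- The families of `r` relations in the characters `S`, other than those in `Y`, that come from
at most `k` traces. -/
noncomputable def families (d k r : ℕ) (S : Finset (Fin c × Φ)) (Y : Finset (Finset (Fin c × Φ))) :
    Finset (Finset (Fin d × Finset (Fin c × Φ))) :=
  (Finset.powersetCard r (Finset.univ ×ˢ (diffs S \ Y))).filter (Traced k S)

theorem mem_families {k r : ℕ} {S : Finset (Fin c × Φ)} {Y : Finset (Finset (Fin c × Φ))}
    {E : Finset (Fin d × Finset (Fin c × Φ))} : E ∈ families d k r S Y ↔
      (∀ t ∈ E, IsDiff S t.2 ∧ t.2 ∉ Y) ∧ E.card = r ∧ Traced k S E := by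
  simp only [families, Finset.mem_filter, Finset.mem_powersetCard, Finset.subset_iff,
    Finset.mem_product, Finset.mem_univ, true_and, Finset.mem_sdiff, mem_diffs, and_assoc]

theorem card_families_le_pairs {k r M : ℕ} {S : Finset (Fin c × Φ)}
    {Y : Finset (Finset (Fin c × Φ))} (hM : (diffs S \ Y).card ≤ M) :
    (families d k r S Y).card ≤ (d * M) ^ r / r.factorial := by
  have hsub : families d k r S Y ⊆ Finset.powersetCard r (Finset.univ ×ˢ (diffs S \ Y)) := by
    intro E hE
    obtain ⟨h1, h2, -⟩ := mem_families.1 hE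
    refine Finset.mem_powersetCard.2 ⟨fun t ht => ?_, h2⟩
    exact Finset.mem_product.2 ⟨Finset.mem_univ _,
      Finset.mem_sdiff.2 ⟨mem_diffs.2 (h1 t ht).1, (h1 t ht).2⟩⟩
  refine (Finset.card_le_card hsub).trans ?_
  rw [Finset.card_powersetCard, Finset.card_product, Finset.card_univ, Fintype.card_fin]
  exact choose_le_pow_div_factorial (Nat.mul_le_mul_left d hM) r

theorem card_families_le_traces {k r K : ℕ} {S : Finset (Fin c × Φ)}
    {Y : Finset (Finset (Fin c × Φ))}
    (hK : ∏ i, ((S.filter fun α => α.1 = i).card + 1) ≤ K) (hk : k ≤ K) :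
    (families d k r S Y).card
      ≤ K ^ k / k.factorial * ((d * k.choose 2) ^ r / r.factorial) := by
  classical
  have hT := (card_traces_le S).trans hK
  let pd : Finset (Finset (Fin c × Φ)) → Finset (Fin c × Φ) := fun p => p.sup id \ p.inf id
  have hpd : ∀ u v, pd {u, v} = u ∆ v := by
    intro u v
    simp only [pd, Finset.sup_insert, Finset.sup_singleton, Finset.inf_insert,
      Finset.inf_singleton, id]
    exact (symmDiff_eq_sup_sdiff_inf u v).symm
  let Qs : Finset (Finset (Finset (Fin c × Φ))) :=
    if k ≤ (traces S).card then Finset.powersetCard k (traces S) else {traces S}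
  have hQs : Qs.card ≤ K ^ k / k.factorial := by
    simp only [Qs]
    split_ifs with h
    · rw [Finset.card_powersetCard]
      exact choose_le_pow_div_factorial hT k
    · rw [Finset.card_singleton, Nat.one_le_div_iff k.factorial_pos]
      exact (Nat.factorial_le_pow k).trans (Nat.pow_le_pow_left hk k)
  have hQk : ∀ Q ∈ Qs, Q.card ≤ k := by
    intro Q hQ
    simp only [Qs] at hQ
    split_ifs at hQ with h
    · exact (Finset.mem_powersetCard.1 hQ).2.le
    · rw [Finset.mem_singleton.1 hQ]; omega
  refine (Finset.card_le_card (t := Qs.biUnion fun Q =>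
    Finset.powersetCard r ((Finset.univ : Finset (Fin d)) ×ˢ (Finset.powersetCard 2 Q).image pd))
    fun E hE => ?_).trans ((Finset.card_biUnion_le_card_mul _ _ _ fun Q hQ => ?_).trans
      (Nat.mul_le_mul_right _ hQs))
  · obtain ⟨hdiff, hr, Q, hQ, htr, huv⟩ := mem_families.1 hE
    have hQT : Q ⊆ traces S := fun u hu => mem_traces.2 (htr u hu)
    obtain ⟨Q', hQ', hQQ'⟩ : ∃ Q' ∈ Qs, Q ⊆ Q' := by
      simp only [Qs]
      split_ifs with h
      · obtain ⟨Q', h1, h2, h3⟩ := Finset.exists_subsuperset_card_eq hQT hQ h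
        exact ⟨Q', Finset.mem_powersetCard.2 ⟨h2, h3⟩, h1⟩
      · exact ⟨_, Finset.mem_singleton_self _, hQT⟩
    refine Finset.mem_biUnion.2 ⟨Q', hQ', Finset.mem_powersetCard.2 ⟨fun t ht => ?_, hr⟩⟩
    obtain ⟨u, hu, v, hv, huv⟩ := huv t ht
    have hne : u ≠ v := by
      rintro rfl
      have := (hdiff t ht).1.2.1
      rw [huv, symmDiff_self] at this
      exact Finset.not_nonempty_empty this
    refine Finset.mem_product.2 ⟨Finset.mem_univ _, Finset.mem_image.2 ⟨{u, v}, ?_, ?_⟩⟩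
    · refine Finset.mem_powersetCard.2 ⟨?_, Finset.card_pair hne⟩
      exact Finset.insert_subset (hQQ' hu) (Finset.singleton_subset_iff.2 (hQQ' hv))
    · rw [hpd, huv]
  · rw [Finset.card_powersetCard, Finset.card_product, Finset.card_univ, Fintype.card_fin]
    refine choose_le_pow_div_factorial (Nat.mul_le_mul_left d (Finset.card_image_le.trans ?_)) r
    rw [Finset.card_powersetCard]
    exact Nat.choose_le_choose 2 (hQk Q hQ)

theorem card_eq_sum_position (S : Finset (Fin c × Φ)) :
    S.card = ∑ i, (S.filter fun α => α.1 = i).card :=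
  Finset.card_eq_sum_card_fiberwise (f := Prod.fst) (fun _ _ => Finset.mem_univ _)

end Families

end Tabulation

namespace Tabulation

open scoped symmDiff

/-! ### Certificates -/

section Certificates

variable {Φ R : Type*} [Fintype Φ] [DecidableEq Φ] {c d : ℕ} [AddCommGroup R]

/-- Some family in `C` consists of `r` independent relations that all hold. -/
def Certified (k : ℕ) (H : Fin c × Φ → Fin d → R)
    (C : Finset (Finset (Fin d × Finset (Fin c × Φ)))) (r : ℕ) : Prop :=
  ∃ E ∈ C, E.card = r ∧ Echelon k E ∧ Holds H E

/-- The characters at position `i`. -/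
def charsAt (Φ : Type*) [Fintype Φ] {c : ℕ} (i : Fin c) : Finset (Fin c × Φ) :=
  Finset.univ.filter fun α => α.1 = i

/-- The characters at positions other than `i`. -/
def charsOff (Φ : Type*) [Fintype Φ] {c : ℕ} (i : Fin c) : Finset (Fin c × Φ) :=
  Finset.univ.filter fun α => α.1 ≠ i

theorem card_charsAt (i : Fin c) : (charsAt Φ i).card = Fintype.card Φ := by
  have : charsAt Φ i = {i} ×ˢ Finset.univ := by
    ext ⟨a, b⟩; simp [charsAt, eq_comm]
  rw [this, Finset.card_product]
  simp

theorem card_charsOff (i : Fin c) : (charsOff Φ i).card = (c - 1) * Fintype.card Φ := by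
  have : charsOff Φ i = Finset.univ.erase i ×ˢ Finset.univ := by
    ext ⟨a, b⟩; simp [charsOff]
  rw [this, Finset.card_product]
  simp

/-- One pair of characters at a common position, related at `q` output positions. -/
def pairCerts (Φ : Type*) [Fintype Φ] [DecidableEq Φ] (c d q : ℕ) :
    Finset (Finset (Fin d × Finset (Fin c × Φ))) :=
  Finset.univ.biUnion fun i : Fin c => (Finset.powersetCard 2 (charsAt Φ i)).biUnion fun e =>
    (Finset.powersetCard q Finset.univ).image fun P => P ×ˢ {e}

/-- Families of `r` relations in `n` characters. -/
noncomputable def levelCerts (Φ : Type*) [Fintype Φ] [DecidableEq Φ] (c d k n r : ℕ) :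
    Finset (Finset (Fin d × Finset (Fin c × Φ))) :=
  (Finset.powersetCard n Finset.univ).biUnion fun S => families d k r S ∅

/-- Families of `r` relations in `a` characters at one position and `s` characters at the other
positions, where `p` of the relations relate the same pair of characters. -/
noncomputable def forcedCerts (Φ : Type*) [Fintype Φ] [DecidableEq Φ] (c d k p a s r : ℕ) :
    Finset (Finset (Fin d × Finset (Fin c × Φ))) :=
  Finset.univ.biUnion fun i : Fin c =>
    (Finset.powersetCard a (charsAt Φ i)).biUnion fun S₁ =>
      (Finset.powersetCard s (charsOff Φ i)).biUnion fun S₂ =>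
        (Finset.powersetCard 2 S₁).biUnion fun e =>
          (Finset.powersetCard p Finset.univ).biUnion fun P =>
            (families d k (r - p) (S₁ ∪ S₂) {e}).image fun C => P ×ˢ {e} ∪ C

theorem card_pairCerts_le (q : ℕ) :
    (pairCerts Φ c d q).card ≤ c * ((Fintype.card Φ).choose 2 * d.choose q) := by
  refine (Finset.card_biUnion_le_card_mul _ _ ((Fintype.card Φ).choose 2 * d.choose q)
    fun i _ => ?_).trans_eq (by simp)
  refine (Finset.card_biUnion_le_card_mul _ _ (d.choose q) fun e _ => ?_).trans_eq
    (by rw [Finset.card_powersetCard, card_charsAt])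
  exact Finset.card_image_le.trans_eq (by simp)

theorem card_levelCerts_le {k n r N : ℕ}
    (hN : ∀ S : Finset (Fin c × Φ), S.card = n → (families d k r S ∅).card ≤ N) :
    (levelCerts Φ c d k n r).card ≤ (c * Fintype.card Φ).choose n * N := by
  refine (Finset.card_biUnion_le_card_mul _ _ N fun S hS =>
    hN S (Finset.mem_powersetCard.1 hS).2).trans_eq ?_
  simp

theorem card_forcedCerts_le {k p a s r N : ℕ}
    (hN : ∀ (i : Fin c) (S₁ S₂ e : Finset (Fin c × Φ)), S₁ ⊆ charsAt Φ i → S₂ ⊆ charsOff Φ i →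
      S₁.card = a → S₂.card = s → e ⊆ S₁ → e.card = 2 →
      (families d k (r - p) (S₁ ∪ S₂) {e}).card ≤ N) :
    (forcedCerts Φ c d k p a s r).card ≤ c * ((Fintype.card Φ).choose a *
      (((c - 1) * Fintype.card Φ).choose s * (a.choose 2 * (d.choose p * N)))) := by
  refine (Finset.card_biUnion_le_card_mul _ _ ((Fintype.card Φ).choose a *
      (((c - 1) * Fintype.card Φ).choose s * (a.choose 2 * (d.choose p * N)))) fun i _ => ?_).trans_eq
        (by simp)
  refine (Finset.card_biUnion_le_card_mul _ _ (((c - 1) * Fintype.card Φ).choose s *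
    (a.choose 2 * (d.choose p * N))) fun S₁ h₁ => ?_).trans_eq
    (by rw [Finset.card_powersetCard, card_charsAt])
  refine (Finset.card_biUnion_le_card_mul _ _ (a.choose 2 * (d.choose p * N))
    fun S₂ h₂ => ?_).trans_eq (by rw [Finset.card_powersetCard, card_charsOff])
  rw [Finset.mem_powersetCard] at h₁ h₂
  refine (Finset.card_biUnion_le_card_mul _ _ (d.choose p * N) fun e he => ?_).trans_eq
    (by rw [Finset.card_powersetCard, h₁.2])
  rw [Finset.mem_powersetCard] at he
  refine (Finset.card_biUnion_le_card_mul _ _ N fun P _ => ?_).trans_eq (by simp)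
  exact Finset.card_image_le.trans (hN i S₁ S₂ e h₁.1 h₂.1 h₁.2 h₂.2 he.1 he.2)

theorem eq_of_add_eq_zero (h2 : ∀ r : R, r + r = 0) {a b : R} (h : a + b = 0) : a = b :=
  add_right_cancel (h.trans (h2 b).symm)

theorem holds_pair (h2 : ∀ r : R, r + r = 0) {H : Fin c × Φ → Fin d → R} {α β : Fin c × Φ}
    (hne : α ≠ β) {P : Finset (Fin d)} (hP : ∀ j ∈ P, H α j = H β j) :
    Holds H (P ×ˢ {({α, β} : Finset (Fin c × Φ))}) := by
  rintro ⟨j, e⟩ ht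
  simp only [Finset.mem_product, Finset.mem_singleton] at ht
  obtain ⟨hj, rfl⟩ := ht
  show ∑ γ ∈ {α, β}, H γ j = 0
  rw [Finset.sum_pair hne, hP j hj, h2]

theorem certified_pair (h2 : ∀ r : R, r + r = 0) {k : ℕ} (hk : 2 ≤ k) {H : Fin c × Φ → Fin d → R}
    {α β : Fin c × Φ} (hne : α ≠ β) (hfst : α.1 = β.1) {q : ℕ} {P : Finset (Fin d)}
    (hq : q ≤ P.card) (hP : ∀ j ∈ P, H α j = H β j) :
    Certified k H (pairCerts Φ c d q) q := by
  obtain ⟨P', hPP', hP'⟩ := Finset.exists_subset_card_eq hq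
  have hH := holds_pair h2 hne fun j hj => hP j (hPP' hj)
  have hat : ({α, β} : Finset (Fin c × Φ)) ∈ Finset.powersetCard 2 (charsAt Φ α.1) := by
    refine Finset.mem_powersetCard.2 ⟨fun γ hγ => ?_, Finset.card_pair hne⟩
    rw [Finset.mem_insert, Finset.mem_singleton] at hγ
    refine Finset.mem_filter.2 ⟨Finset.mem_univ _, ?_⟩
    rcases hγ with rfl | rfl
    · rfl
    · exact hfst.symm
  have hcard : ({α, β} : Finset (Fin c × Φ)).card ≤ 2 := Finset.card_le_two
  have hne' : ({α, β} : Finset (Fin c × Φ)).Nonempty := ⟨α, Finset.mem_insert_self _ _⟩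
  generalize ({α, β} : Finset (Fin c × Φ)) = e at hH hat hcard hne'
  have hmem : ∀ t ∈ P' ×ˢ {e}, t.2 = e := fun t ht =>
    Finset.mem_singleton.1 (Finset.mem_product.1 ht).2
  refine ⟨P' ×ˢ {e}, ?_, by rw [Finset.card_product, hP', Finset.card_singleton, mul_one],
    ⟨⟨fun _ => 0, ?_, ?_⟩, e, ?_, ?_⟩, hH⟩
  · exact Finset.mem_biUnion.2 ⟨α.1, Finset.mem_univ _, Finset.mem_biUnion.2 ⟨e, hat,
      Finset.mem_image_of_mem _ (Finset.mem_powersetCard.2 ⟨Finset.subset_univ _, hP'⟩)⟩⟩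
  · intro t ht
    rw [hmem t ht]
    exact hne'
  · intro t ht t' ht' γ h _ _
    exact Prod.ext h ((hmem t ht).trans (hmem t' ht').symm)
  · intro i
    exact (Finset.card_filter_le _ _).trans (hcard.trans hk)
  · intro t ht
    rw [hmem t ht]

variable {k : ℕ} {H : Fin c × Φ → Fin d → R} {ρ : Fin c × Φ → ℕ} {S : Finset (Fin c × Φ)}
  {E : Finset (Fin d × Finset (Fin c × Φ))}

theorem Traced.mono (h : Traced k S E) {E' : Finset (Fin d × Finset (Fin c × Φ))} (hE : E' ⊆ E) :
    Traced k S E' := by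
  obtain ⟨Q, h1, h2, h3⟩ := h
  exact ⟨Q, h1, h2, fun t ht => h3 t (hE ht)⟩

theorem certified_level (hS : ∀ i, (S.filter fun γ => γ.1 = i).card ≤ k)
    (hT : Triangular ρ E) (hH : Holds H E) (hdiff : ∀ t ∈ E, IsDiff S t.2) (htr : Traced k S E)
    {r : ℕ} (hr : r ≤ E.card) : Certified k H (levelCerts Φ c d k S.card r) r := by
  obtain ⟨E', hE', hcard⟩ := Finset.exists_subset_card_eq hr
  refine ⟨E', Finset.mem_biUnion.2 ⟨S, Finset.mem_powersetCard.2 ⟨Finset.subset_univ _, rfl⟩,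
    mem_families.2 ⟨fun t ht => ⟨hdiff t (hE' ht), Finset.notMem_empty _⟩, hcard,
      htr.mono hE'⟩⟩, hcard, ⟨⟨ρ, hT.mono hE'⟩, S, hS, fun t ht => (hdiff t (hE' ht)).1⟩,
    fun t ht => hH t (hE' ht)⟩

theorem certified_forced (h2 : ∀ r : R, r + r = 0) (hρ : ρ.Injective)
    (hS : ∀ i, (S.filter fun γ => γ.1 = i).card ≤ k)
    (hT : Triangular ρ E) (hH : Holds H E) (hdiff : ∀ t ∈ E, IsDiff S t.2) (htr : Traced k S E)
    {α β : Fin c × Φ} (hne : α ≠ β) (hfst : α.1 = β.1) (hα : α ∈ S) (hβ : β ∈ S)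
    {P : Finset (Fin d)} (hP : ∀ j, j ∈ P ↔ H α j = H β j) {r : ℕ} (hPr : P.card ≤ r)
    (hr : r ≤ E.card) :
    Certified k H (forcedCerts Φ c d k P.card (S.filter fun γ => γ.1 = α.1).card
      (S.filter fun γ => γ.1 ≠ α.1).card r) r := by
  classical
  set e : Finset (Fin c × Φ) := {α, β} with he
  have heα : α ∈ e := by simp [he]
  have heS : e ⊆ S := Finset.insert_subset hα (Finset.singleton_subset_iff.2 hβ)
  obtain ⟨γ, hγ⟩ := exists_isTop ρ ⟨α, heα⟩
  set G := E.filter fun t => t.1 ∈ P ∧ IsTop ρ t.2 γ with hG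
  have hGcard : G.card ≤ P.card := by
    refine Finset.card_le_card_of_injOn Prod.fst (fun t ht => ?_) fun t ht t' ht' h => ?_
    · exact (Finset.mem_filter.1 ht).2.1
    · have h1 := Finset.mem_filter.1 ht
      have h3 := Finset.mem_filter.1 ht'
      exact hT.2 t h1.1 t' h3.1 γ h h1.2.2 h3.2.2
  have hsd : r - P.card ≤ (E \ G).card := by
    have := Finset.le_card_sdiff G E
    omega
  obtain ⟨C, hC, hCcard⟩ := Finset.exists_subset_card_eq hsd
  have hCE : C ⊆ E := hC.trans Finset.sdiff_subset
  have hCe : ∀ t ∈ C, t.2 ≠ e := by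
    intro t ht hte
    obtain ⟨h1, h3⟩ := Finset.mem_sdiff.1 (hC ht)
    refine h3 (Finset.mem_filter.2 ⟨h1, (hP _).2 ?_, hte ▸ hγ⟩)
    have := hH t h1
    rw [hte, he, Finset.sum_pair hne] at this
    exact eq_of_add_eq_zero h2 this
  have hmem : ∀ t ∈ P ×ˢ {e} ∪ C, (t.1 ∈ P ∧ t.2 = e) ∨ t ∈ C := by
    intro t ht
    rw [Finset.mem_union, Finset.mem_product, Finset.mem_singleton] at ht
    exact ht
  have hmix : ∀ t t' : Fin d × Finset (Fin c × Φ), t.1 ∈ P → t.2 = e → t' ∈ C → t.1 = t'.1 → ∀ δ, IsTop ρ t.2 δ →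
      IsTop ρ t'.2 δ → False := by
    intro t t' h1 h3 h4 h5 δ h6 h7
    rw [h3] at h6
    rw [h6.unique hρ hγ] at h7
    obtain ⟨h8, h9⟩ := Finset.mem_sdiff.1 (hC h4)
    exact h9 (Finset.mem_filter.2 ⟨h8, h5 ▸ h1, h7⟩)
  refine ⟨P ×ˢ {e} ∪ C, ?_, ?_, ⟨⟨ρ, ?_, ?_⟩, S, hS, ?_⟩, ?_⟩
  · refine Finset.mem_biUnion.2 ⟨α.1, Finset.mem_univ _, Finset.mem_biUnion.2
      ⟨S.filter fun γ => γ.1 = α.1, ?_, Finset.mem_biUnion.2 ⟨S.filter fun γ => γ.1 ≠ α.1, ?_,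
      Finset.mem_biUnion.2 ⟨e, ?_, Finset.mem_biUnion.2 ⟨P, ?_,
        Finset.mem_image_of_mem _ ?_⟩⟩⟩⟩⟩
    · exact Finset.mem_powersetCard.2 ⟨Finset.filter_subset_filter _ (Finset.subset_univ _), rfl⟩
    · exact Finset.mem_powersetCard.2 ⟨Finset.filter_subset_filter _ (Finset.subset_univ _), rfl⟩
    · refine Finset.mem_powersetCard.2 ⟨fun δ hδ => ?_, Finset.card_pair hne⟩
      refine Finset.mem_filter.2 ⟨heS hδ, ?_⟩
      rw [he, Finset.mem_insert, Finset.mem_singleton] at hδ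
      rcases hδ with rfl | rfl
      · rfl
      · exact hfst.symm
    · exact Finset.mem_powersetCard.2 ⟨Finset.subset_univ _, rfl⟩
    · rw [Finset.filter_union_filter_not_eq]
      exact mem_families.2 ⟨fun t ht => ⟨hdiff t (hCE ht), fun h => hCe t ht
        (Finset.mem_singleton.1 h)⟩, hCcard, htr.mono hCE⟩
  · rw [Finset.card_union_of_disjoint, Finset.card_product, Finset.card_singleton, hCcard]
    · omega
    · rw [Finset.disjoint_left]
      intro t ht htC
      rw [Finset.mem_product, Finset.mem_singleton] at ht
      exact hCe t htC ht.2
  · intro t ht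
    rcases hmem t ht with h | h
    · rw [h.2]; exact ⟨α, heα⟩
    · exact hT.1 t (hCE h)
  · intro t ht t' ht' δ h1 h3 h4
    rcases hmem t ht with h | h <;> rcases hmem t' ht' with h' | h'
    · exact Prod.ext h1 (h.2.trans h'.2.symm)
    · exact (hmix t t' h.1 h.2 h' h1 δ h3 h4).elim
    · exact (hmix t' t h'.1 h'.2 h h1.symm δ h4 h3).elim
    · exact hT.2 t (hCE h) t' (hCE h') δ h1 h3 h4
  · intro t ht
    rcases hmem t ht with h | h
    · rw [h.2]; exact heS
    · exact (hdiff t (hCE h)).1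
  · intro t ht
    rcases hmem t ht with h | h
    · refine holds_pair h2 hne (fun j hj => (hP j).1 hj) t ?_
      exact Finset.mem_product.2 ⟨h.1, Finset.mem_singleton.2 h.2⟩
    · exact hH t (hCE h)

end Certificates

end Tabulation

namespace Tabulation

/-! ### The bound as a natural number -/

theorem pairBound_step : ∀ t < 4, ∀ n ≤ 70, ∀ i ≤ n,
    pairCount i * pairBound t (n - i) ≤ pairBound (t + 1) n := by
  decide +kernel

/-- The parameters of the union bound. The pair of characters of largest degree at a common
position collides at some number `p` of output positions, which is treated as small below `few` and
as large from `many` on. Sets of more than `cut` characters are counted more coarsely. A set of `a`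
characters at the position of the pair and `s` others supports `(L₁ a + L₂ s) / 100` relations,
where `(L₁, L₂)` is `base` for small `p` and `line p` for intermediate `p`; in any case both numbers
are at least `slope`. -/
structure Scheme where
  /-- The number of key characters. -/
  c : ℕ
  /-- The number of output characters. -/
  d : ℕ
  /-- The number of bits of a key character. -/
  keyBits : ℕ
  /-- The number of bits of an output character. -/
  outBits : ℕ
  /-- The bound for small `p`. -/
  few : ℕ
  /-- The bound for large `p`. -/
  many : ℕ
  /-- The largest number of characters that is counted precisely. -/
  cut : ℕ
  /-- The smallest weight. -/
  slope : ℕ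
  /-- The weights for small `p`. -/
  base : ℕ × ℕ
  /-- The weights for intermediate `p`. -/
  line : ℕ → ℕ × ℕ

namespace Scheme

variable (A : Scheme)

/-- The conditions on the parameters. -/
def Valid : Prop :=
  0 < A.c ∧ A.c ≤ 4 ∧ 0 < A.d ∧ 2 ≤ A.cut ∧ A.cut ≤ 70 ∧
  100 ≤ (A.cut + 1 + A.c) ^ A.c / A.c ^ A.c ∧
  A.slope ≤ A.base.2 ∧ A.base.2 ≤ A.base.1 ∧
  2 * (A.base.1 + (A.c - 1) * A.base.2) ≤ 100 * A.d ∧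
  100 * A.few < 2 * A.base.1 + 100 ∧
  ∀ p < A.many, A.few ≤ p → A.slope ≤ (A.line p).1 ∧ A.slope ≤ (A.line p).2 ∧
    100 * p ≤ 2 * (A.line p).1 ∧
    2 * ((A.line p).1 + (A.c - 1) * (A.line p).2) ≤ 100 * A.d

/-- The number of relations in a set of `n` characters. -/
def levelRank (n : ℕ) : ℕ :=
  if n ≤ A.cut then (2 * A.base.1 + (n - 2) * A.base.2 + 99) / 100 else (A.slope * n + 99) / 100

/-- The number of relations in a set of `a + s` characters. -/
def forcedRank (p a s : ℕ) : ℕ := ((A.line p).1 * a + (A.line p).2 * s + 99) / 100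

/-- The number of families of `r` relations among `m` sets of characters. -/
def choices (m r : ℕ) : ℕ := (A.d * m) ^ r / r.factorial

/-- The number of families of `r` relations from `100` out of `K` traces. -/
def traceChoices (K r : ℕ) : ℕ := K ^ 100 / Nat.factorial 100 * A.choices 4950 r

/-- The bound for the number of families of `r` relations, given bounds for the number of relations
and of traces. -/
def familyBound (m K r : ℕ) : ℕ :=
  if 100 ≤ K then min (A.choices m r) (A.traceChoices K r) else A.choices m r

/-- The bound for the number of families of relations in a given set of `n` characters. -/
def levelBound (n : ℕ) : ℕ :=
  if n ≤ A.cut then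
    A.familyBound (pairBound A.c n - 1) ((n + A.c) ^ A.c / A.c ^ A.c) (A.levelRank n)
  else A.traceChoices ((n + A.c) ^ A.c / A.c ^ A.c) (A.levelRank n)

/-- The bound for the number of families of relations in `n` characters. -/
def levelCount (n : ℕ) : ℕ := (A.c * 2 ^ A.keyBits) ^ n / n.factorial * A.levelBound n

/-- The bound for the number of families of relations, besides those for one pair, in given sets
of `a` and `s` characters. -/
def forcedBound (p a s : ℕ) : ℕ :=
  A.familyBound (pairCount a * pairBound (A.c - 1) s - 2)
    ((a + 1) * ((s + (A.c - 1)) ^ (A.c - 1) / (A.c - 1) ^ (A.c - 1))) (A.forcedRank p a s - p)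

/-- The bound for the number of families of relations in `a` and `s` characters. -/
def forcedCount (p a s : ℕ) : ℕ :=
  A.c * ((2 ^ A.keyBits) ^ a / a.factorial * (((A.c - 1) * 2 ^ A.keyBits) ^ s / s.factorial *
    (a * (a - 1) / 2 * (A.d.descFactorial p / p.factorial * A.forcedBound p a s))))

/-- The bound for the number of families of relations for one pair. -/
def pairFamilyCount : ℕ :=
  A.c * ((2 ^ A.keyBits) ^ 2 / Nat.factorial 2 *
    (A.d.descFactorial A.many / A.many.factorial))

/-- The probability `M / 2 ^ b`, in units of `2 ^ (-200)`. -/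
def scaled (M b : ℕ) : ℕ := M * 2 ^ 200 / 2 ^ b + 1

/-- The bound for the failure probability, in units of `2 ^ (-200)`. -/
def total : ℕ :=
  scaled A.pairFamilyCount (A.outBits * A.many) +
  (∑ n ∈ Finset.range (100 * A.c - 2),
    scaled (A.levelCount (n + 3)) (A.outBits * A.levelRank (n + 3))) +
  ∑ p ∈ Finset.range (A.many - A.few), ∑ a ∈ Finset.range (A.cut - 1),
    ∑ s ∈ Finset.range (A.cut - 1 - a), scaled (A.forcedCount (p + A.few) (a + 2) s)
      (A.outBits * A.forcedRank (p + A.few) (a + 2) s)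

/-- The parameters for 32-bit keys. -/
def two : Scheme where
  c := 2
  d := 20
  keyBits := 16
  outBits := 16
  few := 10
  many := 12
  cut := 45
  slope := 448
  base := (502, 498)
  line p := if p = 10 then (502, 498) else (552, 448)

/-- The parameters for 64-bit keys with three characters. -/
def three : Scheme where
  c := 3
  d := 24
  keyBits := 22
  outBits := 22
  few := 8
  many := 11
  cut := 50
  slope := 349
  base := (402, 399)
  line p := if p = 8 then (402, 399) else if p = 9 then (452, 374) else (502, 349)

/-- The parameters for 64-bit keys with four characters. -/
def four : Scheme where
  c := 4
  d := 14
  keyBits := 16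
  outBits := 32
  few := 4
  many := 6
  cut := 70
  slope := 149
  base := (175, 175)
  line p := if p = 4 then (202, 166) else (253, 149)

theorem valid_two : two.Valid := by unfold Valid; decide +kernel

theorem valid_three : three.Valid := by unfold Valid; decide +kernel

theorem valid_four : four.Valid := by unfold Valid; decide +kernel

theorem total_two : two.total * 10 ^ 43 ≤ 15 * 2 ^ 200 := by decide +kernel

theorem total_three : three.total * 10 ^ 50 ≤ 14 * 2 ^ 200 := by decide +kernel

theorem total_four : four.total * 10 ^ 36 ≤ 9 * 2 ^ 200 := by decide +kernel

end Scheme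

end Tabulation

namespace Tabulation

namespace Scheme

/-! ### Correctness of the counts -/

section Counts

variable {Φ : Type*} [Fintype Φ] [DecidableEq Φ] {A : Scheme}

theorem card_families_le_familyBound {S : Finset (Fin A.c × Φ)}
    {Y : Finset (Finset (Fin A.c × Φ))} {m K r : ℕ} (hm : (diffs S \ Y).card ≤ m)
    (hK : ∏ i, ((S.filter fun α => α.1 = i).card + 1) ≤ K) :
    (families A.d 100 r S Y).card ≤ A.familyBound m K r := by
  unfold familyBound
  split_ifs with h
  · exact le_min (card_families_le_pairs hm) (card_families_le_traces hK h)
  · exact card_families_le_pairs hm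

theorem card_families_le_levelBound (hA : A.Valid) {n : ℕ} {S : Finset (Fin A.c × Φ)}
    (hS : S.card = n) : (families A.d 100 (A.levelRank n) S ∅).card ≤ A.levelBound n := by
  obtain ⟨hc, hc4, -, -, hcut, h100, -⟩ := hA
  have hK : ∏ i, ((S.filter fun α => α.1 = i).card + 1) ≤ (n + A.c) ^ A.c / A.c ^ A.c := by
    have := prod_add_one_le Finset.univ fun i => (S.filter fun α => α.1 = i).card
    rwa [← card_eq_sum_position, hS, Finset.card_univ, Fintype.card_fin] at this
  unfold levelBound
  split_ifs with h
  · refine card_families_le_familyBound ?_ hK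
    have h1 := card_diffs_lt S
    have h2 := prod_pairCount_le pairBound_step Finset.univ
      (fun i => (S.filter fun α => α.1 = i).card) (by simpa using hc4)
      (by rw [← card_eq_sum_position]; omega)
    rw [← card_eq_sum_position, hS, Finset.card_univ, Fintype.card_fin] at h2
    rw [Finset.sdiff_empty]
    omega
  · refine card_families_le_traces hK (h100.trans ?_)
    exact Nat.div_le_div_right (Nat.pow_le_pow_left (by omega) _)

theorem card_levelCerts_le_levelCount (hA : A.Valid) (hΦ : Fintype.card Φ = 2 ^ A.keyBits)
    (n : ℕ) : (levelCerts Φ A.c A.d 100 n (A.levelRank n)).card ≤ A.levelCount n := by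
  refine (card_levelCerts_le fun S hS => card_families_le_levelBound hA hS).trans ?_
  rw [hΦ]
  exact Nat.mul_le_mul_right _ (choose_le_pow_div_factorial le_rfl n)

theorem isDiff_pair {i : Fin A.c} {S e : Finset (Fin A.c × Φ)} (heS : e ⊆ S)
    (he : ∀ α ∈ e, α.1 = i) (h2 : e.card = 2) : IsDiff S e := by
  refine ⟨heS, Finset.card_pos.1 (by omega), fun i' => ?_⟩
  by_cases h : i' = i
  · right
    rw [Finset.filter_true_of_mem fun α hα => (he α hα).trans h.symm, h2]
  · left
    exact Finset.filter_eq_empty_iff.2 fun α hα h' => h (h'.symm.trans (he α hα))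

theorem card_families_le_forcedBound (hA : A.Valid) {p a s : ℕ} (has : a + s ≤ A.cut)
    {i : Fin A.c} {S₁ S₂ e : Finset (Fin A.c × Φ)} (hS₁ : S₁ ⊆ charsAt Φ i)
    (hS₂ : S₂ ⊆ charsOff Φ i) (ha : S₁.card = a) (hs : S₂.card = s) (heS : e ⊆ S₁)
    (he : e.card = 2) :
    (families A.d 100 (A.forcedRank p a s - p) (S₁ ∪ S₂) {e}).card ≤ A.forcedBound p a s := by
  obtain ⟨hc, hc4, -, -, hcut, -⟩ := hA
  have h₁ : ∀ α ∈ S₁, α.1 = i := fun α hα => (Finset.mem_filter.1 (hS₁ hα)).2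
  have h₂ : ∀ α ∈ S₂, α.1 ≠ i := fun α hα => (Finset.mem_filter.1 (hS₂ hα)).2
  have hat : (S₁ ∪ S₂).filter (fun α => α.1 = i) = S₁ := by
    rw [Finset.filter_union, Finset.filter_true_of_mem h₁, Finset.filter_false_of_mem h₂,
      Finset.union_empty]
  have hoff : (S₁ ∪ S₂).filter (fun α => α.1 ≠ i) = S₂ := by
    rw [Finset.filter_union, Finset.filter_true_of_mem h₂,
      Finset.filter_false_of_mem fun α hα h => h (h₁ α hα), Finset.empty_union]
  have hsum : ∑ i' ∈ Finset.univ.erase i, ((S₁ ∪ S₂).filter fun α => α.1 = i').card = s := by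
    rw [← card_not_position, hoff, hs]
  have hcard : (Finset.univ.erase i).card = A.c - 1 := by simp
  refine card_families_le_familyBound ?_ ?_
  · have hmem : {e} ⊆ diffs (S₁ ∪ S₂) := Finset.singleton_subset_iff.2 (mem_diffs.2
      (isDiff_pair (heS.trans Finset.subset_union_left) (fun α hα => h₁ α (heS hα)) he))
    rw [Finset.card_sdiff_of_subset hmem, Finset.card_singleton]
    have h1 := card_diffs_lt (S₁ ∪ S₂)
    have h2 := prod_pairCount_le pairBound_step (Finset.univ.erase i)
      (fun i' => ((S₁ ∪ S₂).filter fun α => α.1 = i').card) (by rw [hcard]; omega)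
      (by rw [hsum]; omega)
    rw [hsum, hcard] at h2
    rw [← Finset.mul_prod_erase _ _ (Finset.mem_univ i), hat, ha] at h1
    have h3 := Nat.mul_le_mul_left (pairCount a) h2
    omega
  · rw [← Finset.mul_prod_erase _ _ (Finset.mem_univ i), hat, ha]
    refine Nat.mul_le_mul_left _ ?_
    have := prod_add_one_le (Finset.univ.erase i)
      fun i' => ((S₁ ∪ S₂).filter fun α => α.1 = i').card
    rwa [hsum, hcard] at this

theorem card_forcedCerts_le_forcedCount (hA : A.Valid) (hΦ : Fintype.card Φ = 2 ^ A.keyBits)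
    {p a s : ℕ} (has : a + s ≤ A.cut) :
    (forcedCerts Φ A.c A.d 100 p a s (A.forcedRank p a s)).card ≤ A.forcedCount p a s := by
  refine (card_forcedCerts_le fun i S₁ S₂ e h₁ h₂ ha hs heS he =>
    card_families_le_forcedBound hA has h₁ h₂ ha hs heS he).trans ?_
  rw [hΦ, Nat.choose_two_right, Nat.choose_eq_descFactorial_div_factorial A.d p]
  unfold forcedCount
  gcongr
  · exact choose_le_pow_div_factorial le_rfl a
  · exact choose_le_pow_div_factorial le_rfl s

theorem card_pairCerts_le_pairFamilyCount (hΦ : Fintype.card Φ = 2 ^ A.keyBits) :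
    (pairCerts Φ A.c A.d A.many).card ≤ A.pairFamilyCount := by
  refine (card_pairCerts_le A.many).trans ?_
  rw [hΦ, Nat.choose_eq_descFactorial_div_factorial A.d A.many]
  unfold pairFamilyCount
  gcongr
  exact choose_le_pow_div_factorial le_rfl 2

end Counts

/-! ### Certificates for sets of keys without unique output characters -/

section Certificates

variable {Φ R : Type*} [Fintype Φ] [DecidableEq Φ] [AddCommGroup R] {A : Scheme}

theorem card_le_of_isDiff_pair (h2 : ∀ r : R, r + r = 0) {H : Fin A.c × Φ → Fin A.d → R}
    {α β : Fin A.c × Φ} (hne : α ≠ β) (hfst : α.1 = β.1) {P : Finset (Fin A.d)}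
    (hP : ∀ j, j ∈ P ↔ H α j = H β j) {E : Finset (Fin A.d × Finset (Fin A.c × Φ))}
    (hH : Holds H E) (hdiff : ∀ t ∈ E, IsDiff {α, β} t.2) : E.card ≤ P.card := by
  have he : ∀ t ∈ E, t.2 = {α, β} := by
    intro t ht
    obtain ⟨hsub, ⟨γ, hγ⟩, hpos⟩ := hdiff t ht
    have hfst' : ∀ δ ∈ t.2, δ.1 = α.1 := by
      intro δ hδ
      have := hsub hδ
      rw [Finset.mem_insert, Finset.mem_singleton] at this
      rcases this with rfl | rfl
      · rfl
      · exact hfst.symm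
    have hpos := hpos α.1
    rw [Finset.filter_true_of_mem hfst'] at hpos
    refine Finset.eq_of_subset_of_card_le hsub ?_
    rw [Finset.card_pair hne]
    rcases hpos with h | h
    · rw [h] at hγ; exact absurd hγ (Finset.notMem_empty γ)
    · exact h.ge
  refine Finset.card_le_card_of_injOn Prod.fst (fun t ht => ?_) fun t ht t' ht' h => ?_
  · have := hH t ht
    rw [he t ht, Finset.sum_pair hne] at this
    exact (hP _).2 (eq_of_add_eq_zero h2 this)
  · exact Prod.ext h ((he t ht).trans (he t' ht').symm)

theorem exists_certificate (hA : A.Valid) (h2 : ∀ r : R, r + r = 0)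
    {H : Fin A.c × Φ → Fin A.d → R} {X : Finset (Fin A.c → Φ)} (hX : Covered H X)
    (hcard : X.card ≤ 100) :
    Certified 100 H (pairCerts Φ A.c A.d A.many) A.many ∨
    (∃ n ∈ Finset.range (100 * A.c - 2), Certified 100 H
      (levelCerts Φ A.c A.d 100 (n + 3) (A.levelRank (n + 3))) (A.levelRank (n + 3))) ∨
    ∃ p ∈ Finset.range (A.many - A.few), ∃ a ∈ Finset.range (A.cut - 1),
      ∃ s ∈ Finset.range (A.cut - 1 - a), Certified 100 H
        (forcedCerts Φ A.c A.d 100 (p + A.few) (a + 2) s (A.forcedRank (p + A.few) (a + 2) s))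
        (A.forcedRank (p + A.few) (a + 2) s) := by
  classical
  obtain ⟨hc, hc4, hd, hcut2, hcut, h100, hslope, hbase, hbal, hfew, hline⟩ := hA
  obtain ⟨ρ, α, β, hρ, hne, hfst, hrel⟩ := exists_relations h2 hcard hX hd
  obtain ⟨P, hP⟩ : ∃ P : Finset (Fin A.d), ∀ j, j ∈ P ↔ H α j = H β j :=
    ⟨Finset.univ.filter fun j => H α j = H β j, by simp⟩
  have hlevel : ∀ (S : Finset (Fin A.c × Φ)) (E : Finset (Fin A.d × Finset (Fin A.c × Φ))),
      (∀ i, (S.filter fun γ => γ.1 = i).card ≤ 100) → Triangular ρ E → Holds H E →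
      (∀ t ∈ E, IsDiff S t.2) → Traced 100 S E → 3 ≤ S.card → A.levelRank S.card ≤ E.card →
      ∃ n ∈ Finset.range (100 * A.c - 2), Certified 100 H
        (levelCerts Φ A.c A.d 100 (n + 3) (A.levelRank (n + 3))) (A.levelRank (n + 3)) := by
    intro S E hS hT hH hdiff htr h3 hr
    have hle : S.card ≤ 100 * A.c := by
      rw [card_eq_sum_position]
      refine (Finset.sum_le_sum fun i _ => hS i).trans_eq ?_
      simp [mul_comm]
    refine ⟨S.card - 3, Finset.mem_range.2 (by omega), ?_⟩
    rw [Nat.sub_add_cancel h3]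
    exact certified_level hS hT hH hdiff htr hr
  have hsplit : ∀ S : Finset (Fin A.c × Φ), S.card = (S.filter fun γ => γ.1 = α.1).card +
      (S.filter fun γ => γ.1 ≠ α.1).card := fun S =>
    (Finset.card_filter_add_card_filter_not _).symm
  have hpair : ∀ S : Finset (Fin A.c × Φ), α ∈ S → β ∈ S →
      {α, β} ⊆ S.filter fun γ => γ.1 = α.1 := by
    intro S hα hβ
    refine Finset.insert_subset (Finset.mem_filter.2 ⟨hα, rfl⟩)
      (Finset.singleton_subset_iff.2 (Finset.mem_filter.2 ⟨hβ, hfst.symm⟩))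
  rcases le_or_gt A.many P.card with hp | hp
  · exact Or.inl (certified_pair h2 (by norm_num) hne hfst hp fun j hj => (hP j).1 hj)
  right
  rcases lt_or_ge P.card A.few with hp' | hp'
  · left
    obtain ⟨S, E, hα, hβ, hS, hT, hH, hdiff, htr, hle⟩ := hrel _ _ _ hbal
    have hsub := hpair S hα hβ
    have ha := Finset.card_le_card hsub
    rw [Finset.card_pair hne] at ha
    have hn := hsplit S
    obtain ⟨a, ha'⟩ := Nat.exists_eq_add_of_le ha
    have hmul : 2 * A.base.1 + (S.card - 2) * A.base.2 ≤ 100 * E.card := by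
      refine le_trans ?_ hle
      have e : S.card - 2 = a + (S.filter fun γ => γ.1 ≠ α.1).card := by omega
      rw [e, ha']
      nlinarith [Nat.mul_le_mul_left a hbase]
    refine hlevel S E hS hT hH hdiff htr ?_ ?_
    · by_contra hlt
      have hSeq : S = {α, β} := (Finset.eq_of_subset_of_card_le
        (hsub.trans (Finset.filter_subset _ _)) (by rw [Finset.card_pair hne]; omega)).symm
      have hEP := card_le_of_isDiff_pair h2 hne hfst hP hH (hSeq ▸ hdiff)
      have : 2 * A.base.1 ≤ 100 * E.card := le_trans (Nat.le_add_right _ _) hmul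
      omega
    · unfold levelRank
      split_ifs with h
      · omega
      · have h1 : A.slope * S.card ≤ 2 * A.base.1 + (S.card - 2) * A.base.2 := by
          have e : S.card = 2 + (S.card - 2) := by omega
          generalize S.card - 2 = m at e ⊢
          rw [e]
          nlinarith [Nat.mul_le_mul_left m hslope]
        omega
  · obtain ⟨hs1, hs2, hp100, hbal'⟩ := hline P.card hp hp'
    obtain ⟨S, E, hα, hβ, hS, hT, hH, hdiff, htr, hle⟩ := hrel _ _ _ hbal'
    have hsub := hpair S hα hβ
    have ha := Finset.card_le_card hsub
    rw [Finset.card_pair hne] at ha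
    have hn := hsplit S
    rcases lt_or_ge A.cut S.card with hcutS | hcutS
    · left
      refine hlevel S E hS hT hH hdiff htr (by omega) ?_
      rw [levelRank, if_neg (by omega)]
      have : A.slope * S.card ≤ 100 * E.card := by
        refine le_trans ?_ hle
        rw [hn, Nat.mul_add]
        exact Nat.add_le_add (Nat.mul_le_mul_right _ hs1) (Nat.mul_le_mul_right _ hs2)
      omega
    · right
      refine ⟨P.card - A.few, Finset.mem_range.2 (by omega),
        (S.filter fun γ => γ.1 = α.1).card - 2, Finset.mem_range.2 (by omega),
        (S.filter fun γ => γ.1 ≠ α.1).card, Finset.mem_range.2 (by omega), ?_⟩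
      rw [Nat.sub_add_cancel hp', Nat.sub_add_cancel ha]
      refine certified_forced h2 hρ hS hT hH hdiff htr hne hfst hα hβ hP ?_ ?_
      · have := Nat.mul_le_mul_left (A.line P.card).1 ha
        unfold forcedRank
        omega
      · unfold forcedRank
        omega

end Certificates

/-! ### The union bound -/

section Probability

variable {Ω : Type*} [MeasurableSpace Ω] {μ : Measure Ω} [IsProbabilityMeasure μ]
  {Φ : Type*} [Fintype Φ] [DecidableEq Φ]

theorem measureReal_certified_le {c d s : ℕ} (hΦ : 100 ≤ Fintype.card Φ)
    {h : Fin c → Ω → Φ → Fin d → BitVec s} (hh : AreRandomTables 100 μ h)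
    {C : Finset (Finset (Fin d × Finset (Fin c × Φ)))} {r M : ℕ} (hM : C.card ≤ M) :
    μ.real {ω | Certified 100 (entries fun i => h i ω) C r} ≤ (scaled M (s * r) : ℝ) / 2 ^ 200 := by
  have h1 := measure_exists_holds_le hΦ hh C (r := r)
  have h2 : μ.real {ω | Certified 100 (entries fun i => h i ω) C r}
      ≤ (C.card : ℝ) * ((2 ^ s)⁻¹) ^ r := by
    have := ENNReal.toReal_mono (by
      refine ENNReal.mul_ne_top (ENNReal.natCast_ne_top _) (ENNReal.pow_ne_top ?_)
      exact ENNReal.inv_ne_top.2 (pow_ne_zero _ two_ne_zero)) h1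
    refine LE.le.trans_eq this ?_
    simp
  refine h2.trans ?_
  have h3 : M * 2 ^ 200 ≤ 2 ^ (s * r) * scaled M (s * r) :=
    (Nat.lt_mul_div_succ _ (by positivity)).le
  have h4 : (M : ℝ) * 2 ^ 200 ≤ 2 ^ (s * r) * (scaled M (s * r) : ℝ) := by exact_mod_cast h3
  rw [inv_pow, ← pow_mul, ← div_eq_mul_inv, div_le_div_iff₀ (by positivity) (by positivity),
    mul_comm (scaled M (s * r) : ℝ)]
  refine le_trans ?_ h4
  gcongr

theorem covered_of_not_hasUniqueOutputChar {c d s : ℕ} {h : Fin c → Φ → Fin d → BitVec s}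
    {X : Finset (Fin c → Φ)} (hX : X.Nonempty)
    (hu : ¬ HasUniqueOutputChar (simpleTabulation h) X) : Covered (entries h) X := by
  refine ⟨hX, fun x hx j => ?_⟩
  have key : ∀ y, hashSum (entries h) y j = XorBits.ofBits (simpleTabulation h y j) := by
    intro y
    rw [hashSum, sum_keySet]
    exact (XorBits.ofBits_fold Finset.univ fun i => h i (y i) j).symm
  by_contra hcon
  refine hu ⟨j, _, x, hx, rfl, fun y hy hyx he => hcon ⟨y, hy, hyx, ?_⟩⟩
  rw [key, key, he]

theorem measureReal_not_isKUnique_le {A : Scheme} (hA : A.Valid)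
    (hΦ : Fintype.card Φ = 2 ^ A.keyBits) (hΦ' : 100 ≤ Fintype.card Φ)
    {h : Fin A.c → Ω → Φ → Fin A.d → BitVec A.outBits} (hh : AreRandomTables 100 μ h) :
    μ.real {ω | ¬ IsKUnique 100 (simpleTabulation fun i => h i ω)}
      ≤ (A.total : ℝ) / 2 ^ 200 := by
  have hsub : {ω | ¬ IsKUnique 100 (simpleTabulation fun i => h i ω)} ⊆
      ({ω | Certified 100 (entries fun i => h i ω) (pairCerts Φ A.c A.d A.many) A.many} ∪
      ⋃ n ∈ Finset.range (100 * A.c - 2), {ω | Certified 100 (entries fun i => h i ω)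
        (levelCerts Φ A.c A.d 100 (n + 3) (A.levelRank (n + 3))) (A.levelRank (n + 3))}) ∪
      ⋃ p ∈ Finset.range (A.many - A.few), ⋃ a ∈ Finset.range (A.cut - 1),
        ⋃ s ∈ Finset.range (A.cut - 1 - a), {ω | Certified 100 (entries fun i => h i ω)
          (forcedCerts Φ A.c A.d 100 (p + A.few) (a + 2) s (A.forcedRank (p + A.few) (a + 2) s))
          (A.forcedRank (p + A.few) (a + 2) s)} := by
    intro ω hω
    simp only [Set.mem_ofPred_eq, IsKUnique, not_forall] at hω
    obtain ⟨X, hX, hcard, hu⟩ := hω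
    have := exists_certificate hA XorBits.add_self (covered_of_not_hasUniqueOutputChar hX hu) hcard
    simp only [Set.mem_union, Set.mem_iUnion, Set.mem_ofPred_eq, exists_prop]
    rw [or_assoc]
    exact this
  refine (measureReal_mono hsub).trans ?_
  unfold total
  push_cast
  rw [add_div, add_div, Finset.sum_div, Finset.sum_div]
  refine (measureReal_union_le _ _).trans (add_le_add ((measureReal_union_le _ _).trans
    (add_le_add ?_ ?_)) ?_)
  · exact measureReal_certified_le hΦ' hh (card_pairCerts_le_pairFamilyCount hΦ)
  · refine (measureReal_biUnion_finset_le _ _).trans (Finset.sum_le_sum fun n _ => ?_)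
    exact measureReal_certified_le hΦ' hh (card_levelCerts_le_levelCount hA hΦ (n + 3))
  · refine (measureReal_biUnion_finset_le _ _).trans (Finset.sum_le_sum fun p _ => ?_)
    rw [Finset.sum_div]
    refine (measureReal_biUnion_finset_le _ _).trans (Finset.sum_le_sum fun a ha => ?_)
    rw [Finset.sum_div]
    refine (measureReal_biUnion_finset_le _ _).trans (Finset.sum_le_sum fun s hs => ?_)
    rw [Finset.mem_range] at ha hs
    exact measureReal_certified_le hΦ' hh (card_forcedCerts_le_forcedCount hA hΦ (by omega))

end Probability

end Scheme

theorem card_bitVec (s : ℕ) : Fintype.card (BitVec s) = 2 ^ s := XorBits.card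

end Tabulation

theorem theorem6 {Ω : Type*} [MeasurableSpace Ω] (μ : Measure Ω) [IsProbabilityMeasure μ] :
    (∀ h : Fin 2 → Ω → BitVec 16 → Fin 20 → BitVec 16, Tabulation.AreRandomTables 100 μ h →
      μ.real {ω | ¬ Tabulation.IsKUnique 100 (Tabulation.simpleTabulation fun i => h i ω)}
        ≤ 1.5 * (10 : ℝ) ^ (-42 : ℤ)) ∧
    (∀ h : Fin 3 → Ω → BitVec 22 → Fin 24 → BitVec 22, Tabulation.AreRandomTables 100 μ h →
      μ.real {ω | ¬ Tabulation.IsKUnique 100 (Tabulation.simpleTabulation fun i => h i ω)}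
        ≤ 1.4 * (10 : ℝ) ^ (-49 : ℤ)) ∧
    (∀ h : Fin 4 → Ω → BitVec 16 → Fin 14 → BitVec 32, Tabulation.AreRandomTables 100 μ h →
      μ.real {ω | ¬ Tabulation.IsKUnique 100 (Tabulation.simpleTabulation fun i => h i ω)}
        ≤ 9.0 * (10 : ℝ) ^ (-36 : ℤ)) := by
  have hcard : ∀ s : ℕ, 7 ≤ s → 100 ≤ Fintype.card (BitVec s) := by
    intro s hs
    rw [Tabulation.card_bitVec]
    exact le_trans (by norm_num) (Nat.pow_le_pow_right two_pos hs)
  have hfinal : ∀ (T N e : ℕ), T * 10 ^ e ≤ N * 2 ^ 200 → (T : ℝ) / 2 ^ 200 ≤ N / 10 ^ e := by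
    intro T N e h
    rw [div_le_div_iff₀ (by positivity) (by positivity)]
    exact_mod_cast h
  refine ⟨fun h hh => ?_, fun h hh => ?_, fun h hh => ?_⟩
  · refine ((Tabulation.Scheme.measureReal_not_isKUnique_le Tabulation.Scheme.valid_two
      (Tabulation.card_bitVec 16) (hcard 16 (by norm_num)) hh).trans
      (hfinal _ _ _ Tabulation.Scheme.total_two)).trans ?_
    norm_num
  · refine ((Tabulation.Scheme.measureReal_not_isKUnique_le Tabulation.Scheme.valid_three
      (Tabulation.card_bitVec 22) (hcard 22 (by norm_num)) hh).trans
      (hfinal _ _ _ Tabulation.Scheme.total_three)).trans ?_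
    norm_num
  · refine ((Tabulation.Scheme.measureReal_not_isKUnique_le Tabulation.Scheme.valid_four
      (Tabulation.card_bitVec 16) (hcard 16 (by norm_num)) hh).trans
      (hfinal _ _ _ Tabulation.Scheme.total_four)).trans ?_
    norm_num
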